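/- Let $n\in\mathbb N$ and $p\in[2,n)$, let $\Omega\subset\mathbb R^n$ be open, and let $\mu$ be a nonnegative finite Radon measure on $\Omega$, extended by zero to $\mathbb R^n$. Write $B(x,t)$ for the open ball. For $r>0$ let $$W^\mu_{1,p}(x,r)=\int_0^r\Big(\frac{\mu(B(x,t))}{t^{n-p}}\Big)^{\frac1{p-1}}\frac{dt}{t}\in[0,\infty]$$ be the Wolff potential. For a compact subset $K$ of an open set $U\subset\mathbb R^n$ let $$\mathrm{cap}_p(K,U)=\inf\Big\{\int_U|\nabla u|^p\,dx:\ u\in C_0^\infty(U),\ u\ge1\text{ on }K\Big\},$$ and for an arbitrary $E\subset U$ let $$\mathrm{cap}_p(E,U)=\inf_{\substack{G\text{ open}\\ E\subset G\subset U}}\ \sup_{\substack{K\text{ compact}\\ K\subset G}}\mathrm{cap}_p(K,U).$$ A set $E\subset\mathbb R^n$ is called $p$-thin for singular behavior at $x_0$ if $$\sum_{i=1}^\infty\frac{\mathrm{cap}_p(E\cap\omega_i(x_0),\Omega_i(x_0))}{\mathrm{cap}_p(\partial B(x_0,2^{-i}),B(x_0,2^{-i+1}))}<\infty,$$ where $\omega_i(x_0)=\{x:2^{-i}\le|x-x_0|\le2^{-i+1}\}$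 and $\Omega_i(x_0)=\{x:2^{-i-1}<|x-x_0|<2^{-i+2}\}$. Theorem 5.2. Let $x_0\in\Omega$, let $r_0>0$ satisfy $B(x_0,3r_0)\subset\Omega$, and suppose that for some $m\in(0,n-p)$ and some constant $C_0$ $$\mu(B(x_0,t))\le C_0t^m\qquad\text{for all }t\in(0,3r_0).$$ Then for every $\varepsilon>0$ there are a set $E\subset\Omega$ that is $p$-thin for singular behavior at $x_0$ and a constant $C>0$ such that $$W^\mu_{1,p}(x,r_0)\le C\,|x-x_0|^{-\frac{n-p-m+\varepsilon}{p-1}}\qquad\text{for all }x\in\Omega\setminus E,$$ where the right-hand side is $+\infty$ at $x=x_0$. -/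

import Mathlib

open MeasureTheory Set
open scoped ENNReal

noncomputable section

/-- The Wolff potential `W^μ_{1,p}(x, r) = ∫₀^r (μ(B(x,t)) / t^(n-p))^(1/(p-1)) dt/t`
of a measure on `ℝⁿ`, with values in `[0, ∞]`. -/
def wolffPotential {n : ℕ} (p : ℝ) (μ : Measure (EuclideanSpace ℝ (Fin n)))
    (x : EuclideanSpace ℝ (Fin n)) (r : ℝ) : ℝ≥0∞ :=
  ∫⁻ t in Ioo (0 : ℝ) r,
    (μ (Metric.ball x t) / ENNReal.ofReal (t ^ ((n : ℝ) - p))) ^ (1 / (p - 1)) / ENNReal.ofReal t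

/-- `u ∈ C₀^∞(Ω)` and `u ≥ 1` on `K`. -/
structure IsCapacityTest {n : ℕ} (K Ω : Set (EuclideanSpace ℝ (Fin n)))
    (u : EuclideanSpace ℝ (Fin n) → ℝ) : Prop where
  smooth : ContDiff ℝ ((⊤ : ℕ∞) : WithTop ℕ∞) u
  compactSupport : HasCompactSupport u
  support_subset : tsupport u ⊆ Ω
  one_le : ∀ x ∈ K, 1 ≤ u x

/-- The `p`-capacity `cap_p(K, Ω) = inf ∫_Ω |∇u|^p dx` of a compact subset `K` of an open set `Ω`,
the infimum being over all `u ∈ C₀^∞(Ω)` with `u ≥ 1` on `K`. -/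
def pCapacityCompact {n : ℕ} (p : ℝ) (K Ω : Set (EuclideanSpace ℝ (Fin n))) : ℝ≥0∞ :=
  ⨅ (u : EuclideanSpace ℝ (Fin n) → ℝ) (_ : IsCapacityTest K Ω u),
    ∫⁻ x in Ω, ‖gradient u x‖ₑ ^ p

/-- The `p`-capacity of an arbitrary subset `E` of an open set `Ω`: the infimum over all open `G`
with `E ⊆ G ⊆ Ω` of the supremum of `cap_p(K, Ω)` over the compact subsets `K` of `G`. -/
def pCapacity {n : ℕ} (p : ℝ) (E Ω : Set (EuclideanSpace ℝ (Fin n))) : ℝ≥0∞ :=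
  ⨅ (G : Set (EuclideanSpace ℝ (Fin n))) (_ : IsOpen G ∧ E ⊆ G ∧ G ⊆ Ω),
    ⨆ (K : Set (EuclideanSpace ℝ (Fin n))) (_ : IsCompact K ∧ K ⊆ G), pCapacityCompact p K Ω

/-- The closed dyadic annulus `ω_i(x₀) = {x : 2^(-i) ≤ |x - x₀| ≤ 2^(-i+1)}`. -/
def dyadicAnnulus {n : ℕ} (x₀ : EuclideanSpace ℝ (Fin n)) (i : ℕ) :
    Set (EuclideanSpace ℝ (Fin n)) :=
  {x | (2 : ℝ) ^ (-(i : ℤ)) ≤ ‖x - x₀‖ ∧ ‖x - x₀‖ ≤ (2 : ℝ) ^ (-(i : ℤ) + 1)}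

/-- The open annulus `Ω_i(x₀) = {x : 2^(-i-1) < |x - x₀| < 2^(-i+2)}`, a neighbourhood of
`ω_i(x₀)`. -/
def dyadicAnnulusNhd {n : ℕ} (x₀ : EuclideanSpace ℝ (Fin n)) (i : ℕ) :
    Set (EuclideanSpace ℝ (Fin n)) :=
  {x | (2 : ℝ) ^ (-(i : ℤ) - 1) < ‖x - x₀‖ ∧ ‖x - x₀‖ < (2 : ℝ) ^ (-(i : ℤ) + 2)}

/-- `E` is `p`-thin for singular behavior at `x₀` (for `1 < p < n`):
`∑_{i ≥ 1} cap_p(E ∩ ω_i, Ω_i) / cap_p(∂B(x₀, 2^(-i)), B(x₀, 2^(-i+1))) < ∞`.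
The summation index `j : ℕ` stands for `i = j + 1`. For `1 < p < n` the denominators are
positive and finite. -/
def IsPThin {n : ℕ} (p : ℝ) (E : Set (EuclideanSpace ℝ (Fin n)))
    (x₀ : EuclideanSpace ℝ (Fin n)) : Prop :=
  ∑' j : ℕ, pCapacity p (E ∩ dyadicAnnulus x₀ (j + 1)) (dyadicAnnulusNhd x₀ (j + 1)) /
    pCapacity p (Metric.sphere x₀ ((2 : ℝ) ^ (-((j + 1 : ℕ) : ℤ))))
      (Metric.ball x₀ ((2 : ℝ) ^ (-((j + 1 : ℕ) : ℤ) + 1))) < ⊤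

end

/-!
The exceptional set is `E = {x ∈ Ω | W x > C |x - x₀| ^ (-β)}`, where `W` is the Wolff potential
and `β = (n - p - m + ε) / (p - 1)`, so the pointwise bound off `E` holds by definition and the
content is that `E` is thin. On the annulus of radius `r = 2 ^ (-i)` the growth of `μ` at `x₀`
bounds the part of `W` coming from scales above `r / 16` by `C r ^ (-(n - p - m) / (p - 1))`, so
on `E ∩ ω_i` the small scales must be responsible. There only the restriction of `μ` to a slightly
larger annulus matters; normalized to a measure `ν` of mass at most `C r ^ (n - p)`, it has a
Wolff potential that exceeds `L = r ^ (-ε / (p - 1))` on `E ∩ ω_i`.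

The core is the weak-type estimate `exists_pCapacity_le`: the set where the potential of `ν`
exceeds `L` has capacity at most `C ν(ℝⁿ) / log (1 + c L) ^ p`. Since `log (1 + c L)` grows
linearly in `i`, and `exists_le_pCapacity_sphere` bounds the denominators below by
`c r ^ (n - p)`, the terms of the series defining thinness are at most `C i ^ (-p)`, and `p > 1`.
A power of `L`, which is what the sharp weak-type bound gives, is not needed: the exponent `ε`
leaves room for the loss.

For the weak-type estimate the test function is `log (1 + w) / log (1 + c L)`, where `w = ∑ g_k`
and `g_k` is a smooth average at scale `ρ / 2 ^ k` of the dyadic term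
`D_k(x) = (ν(B(x, ρ / 2 ^ k)) / (ρ / 2 ^ k) ^ (n - p)) ^ (1 / (p - 1))`. Averaging keeps `g_k`
supported near the support of `ν`, so no cutoff is required, and gives `|∇ g_k| ≤ C A_k` with
`A_k = 2 ^ k D_k / ρ`, up to a shift of the index of `D`. The energy `∫ (∑ A_k) ^ p / (1 + w) ^ 2`
is estimated by `(∑ A_k) ^ p ≤ C ∑_{j ≤ k} (3/2) ^ (k - j) A_k ^ (p - 1) A_j`
(`exists_sum_rpow_le_sum_mul`, where `p ≥ 2` enters). Now `A_k ^ (p - 1)` is linear in `ν`; Fubini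
moves the integral to `ν`, up to constants replaces the other factors by their values on the
support of `ν`, and gains `2 ^ (-(k - j))`. What remains is
`∫ ∑_j D_j / (1 + c ∑_{l ≤ j} D_l) ^ 2 dν`, in which the sum telescopes
(`sum_div_one_add_sum_sq_le`).
-/

/-! ### Inequalities for finite sums -/

/-- Convexity of `x ^ s`, with weights chosen so that the second term is multiplied by `3 / 2`
only; this makes the inequality iterable against a geometric weight. -/
theorem exists_add_rpow_le {s : ℝ} (hs : 1 ≤ s) :
    ∃ C : ℝ, 0 < C ∧ ∀ a b : ℝ, 0 ≤ a → 0 ≤ b →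
      (a + b) ^ s ≤ C * a ^ s + 3 / 2 * b ^ s := by
  -- `τ ^ (-s) = 3 / 2`, so the second weight contributes at most `τ ^ (1 - s) ≤ 3 / 2`.
  set τ : ℝ := (2 / 3 : ℝ) ^ (1 / s) with hτ
  have hs0 : 0 < s := by linarith
  have hτ0 : 0 < τ := by positivity
  have hτ1 : τ < 1 := Real.rpow_lt_one (by norm_num) (by norm_num) (by positivity)
  have hτs : τ ^ (1 - s) ≤ 3 / 2 := by
    have h1 : τ ^ (-s) = 3 / 2 := by
      rw [hτ, ← Real.rpow_mul (by norm_num)]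
      rw [show 1 / s * -s = -1 by field_simp, Real.rpow_neg_one]; norm_num
    rw [← h1]
    exact Real.rpow_le_rpow_of_exponent_ge hτ0 hτ1.le (by linarith)
  refine ⟨(1 - τ) ^ (1 - s), Real.rpow_pos_of_pos (by linarith) _, fun a b ha hb => ?_⟩
  have hx : a / (1 - τ) ∈ Ici (0 : ℝ) := div_nonneg ha (by linarith)
  have hy : b / τ ∈ Ici (0 : ℝ) := div_nonneg hb hτ0.le
  have key := (convexOn_rpow hs).2 hx hy (by linarith : 0 ≤ 1 - τ) hτ0.le (by ring)
  simp only [smul_eq_mul] at key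
  have h1τ : 0 < 1 - τ := by linarith
  rw [mul_div_cancel₀ _ h1τ.ne', mul_div_cancel₀ _ hτ0.ne',
    Real.div_rpow ha h1τ.le, Real.div_rpow hb hτ0.le] at key
  refine key.trans (add_le_add (le_of_eq ?_) ?_)
  · rw [Real.rpow_sub h1τ, Real.rpow_one]; ring
  · calc τ * (b ^ s / τ ^ s) = τ ^ (1 - s) * b ^ s := by
          rw [Real.rpow_sub hτ0, Real.rpow_one]; ring
      _ ≤ _ := by gcongr

/-- A power of a sum is controlled by the sum of powers, at the cost of a geometric weight whose
ratio `3 / 2` is smaller than `2`. -/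
theorem exists_sum_rpow_le {s : ℝ} (hs : 1 ≤ s) :
    ∃ C : ℝ, 0 < C ∧ ∀ (N : ℕ) (A : ℕ → ℝ), (∀ k, 0 ≤ A k) →
      (∑ k ∈ Finset.range N, A k) ^ s ≤ C * ∑ k ∈ Finset.range N, (3 / 2) ^ k * A k ^ s := by
  obtain ⟨C, hC, h⟩ := exists_add_rpow_le hs
  refine ⟨C, hC, fun N => ?_⟩
  induction N with
  | zero => intro A _; simp [Real.zero_rpow (by linarith : s ≠ 0)]
  | succ N ih =>
    intro A hA
    rw [Finset.sum_range_succ', Finset.sum_range_succ', add_comm]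
    refine (h _ _ (hA 0) (Finset.sum_nonneg fun k _ => hA _)).trans ?_
    have := ih (fun k => A (k + 1)) (fun k => hA _)
    have e : ∑ k ∈ Finset.range N, (3 / 2 : ℝ) ^ (k + 1) * A (k + 1) ^ s
        = 3 / 2 * ∑ k ∈ Finset.range N, (3 / 2 : ℝ) ^ k * A (k + 1) ^ s := by
      rw [Finset.mul_sum]; exact Finset.sum_congr rfl fun k _ => by ring
    rw [e]; simp only [pow_zero, one_mul]; linarith

/-- The tangent line bound for `x ^ p` at `a + b`, a form of Bernoulli's inequality. -/
theorem add_rpow_le_rpow_add_mul {p a b : ℝ} (hp : 1 ≤ p) (ha : 0 ≤ a) (hb : 0 ≤ b) :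
    (a + b) ^ p ≤ b ^ p + p * (a * (a + b) ^ (p - 1)) := by
  rcases (add_nonneg ha hb).eq_or_lt with h | h
  · have ha' : a = 0 := by linarith
    have hb' : b = 0 := by linarith
    simp [ha', hb']
  · have h1 := one_add_mul_self_le_rpow_one_add (s := -(a / (a + b))) (p := p)
      (by rw [neg_le_neg_iff, div_le_one h]; linarith) hp
    have e : 1 + -(a / (a + b)) = b / (a + b) := by field_simp; ring
    rw [e, Real.div_rpow hb h.le, le_div_iff₀ (by positivity)] at h1
    have e2 : (a + b) ^ p = (a + b) * (a + b) ^ (p - 1) := by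
      rw [Real.rpow_sub h, Real.rpow_one]; field_simp
    have e3 : a / (a + b) * (a + b) ^ p = a * (a + b) ^ (p - 1) := by
      rw [e2]; field_simp
    nlinarith

/-- The `p`-th power of a sum is controlled by products `A_k ^ (p - 1) A_j` with `j ≤ k`. Here
`p - 1 ≥ 1` is used for the convexity of `x ^ (p - 1)`. -/
theorem exists_sum_rpow_le_sum_mul {p : ℝ} (hp : 2 ≤ p) :
    ∃ C : ℝ, 0 < C ∧ ∀ (N : ℕ) (A : ℕ → ℝ), (∀ k, 0 ≤ A k) →
      (∑ k ∈ Finset.range N, A k) ^ p ≤ C * ∑ j ∈ Finset.range N, ∑ k ∈ Finset.range (N - j),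
        (3 / 2) ^ k * (A (j + k) ^ (p - 1) * A j) := by
  obtain ⟨C, hC, h⟩ := exists_sum_rpow_le (s := p - 1) (by linarith)
  refine ⟨p * C, by positivity, fun N => ?_⟩
  induction N with
  | zero => intro A _; simp [Real.zero_rpow (by linarith : p ≠ 0)]
  | succ N ih =>
    intro A hA
    have h1 := add_rpow_le_rpow_add_mul (p := p) (by linarith) (hA 0)
      (Finset.sum_nonneg fun k (_ : k ∈ Finset.range N) => hA (k + 1))
    have h2 := h (N + 1) A hA
    rw [add_comm (A 0), ← Finset.sum_range_succ' (fun k => A k)] at h1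
    have h3 := ih (fun k => A (k + 1)) (fun k => hA _)
    refine le_trans ?_ (mul_le_mul_of_nonneg_left (Finset.sum_range_succ' _ N).ge (by positivity))
    simp only [Nat.add_sub_add_right, tsub_zero, zero_add]
    have e1 : ∀ j k, A (j + 1 + k) = A (j + k + 1) := fun j k => by congr 1; omega
    simp only [e1]
    have e2 : ∑ k ∈ Finset.range (N + 1), (3 / 2 : ℝ) ^ k * (A k ^ (p - 1) * A 0)
        = A 0 * ∑ k ∈ Finset.range (N + 1), (3 / 2 : ℝ) ^ k * A k ^ (p - 1) := by
      rw [Finset.mul_sum]; exact Finset.sum_congr rfl fun k _ => by ring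
    rw [e2, mul_add]
    have h4 := mul_le_mul_of_nonneg_left h2 (mul_nonneg (by linarith : (0 : ℝ) ≤ p) (hA 0))
    linarith

/-- The summands are at most the differences of `-c⁻¹ (1 + c ∑_{l < j} b_l)⁻¹`. -/
theorem sum_div_one_add_sum_sq_le {c : ℝ} (hc : 0 < c) {b : ℕ → ℝ} (hb : ∀ k, 0 ≤ b k) (N : ℕ) :
    ∑ j ∈ Finset.range N, b j / (1 + c * ∑ l ∈ Finset.range (j + 1), b l) ^ 2 ≤
      c⁻¹ * (1 - (1 + c * ∑ l ∈ Finset.range N, b l)⁻¹) := by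
  induction N with
  | zero => simp
  | succ N ih =>
    rw [Finset.sum_range_succ]
    set S := ∑ l ∈ Finset.range N, b l
    have hS : 0 ≤ S := Finset.sum_nonneg fun k _ => hb k
    rw [Finset.sum_range_succ]
    have hbN := hb N
    have h1 : 0 < 1 + c * S := by positivity
    have h2 : 0 < 1 + c * (S + b N) := by positivity
    have key : b N / (1 + c * (S + b N)) ^ 2 ≤
        c⁻¹ * ((1 + c * S)⁻¹ - (1 + c * (S + b N))⁻¹) := by
      have e : c⁻¹ * ((1 + c * S)⁻¹ - (1 + c * (S + b N))⁻¹)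
          = b N / ((1 + c * S) * (1 + c * (S + b N))) := by
        field_simp; ring
      rw [e, pow_two]
      gcongr
      linarith
    linarith

/-- Variant of `sum_div_one_add_sum_sq_le` in which the first four terms do not enter the
denominators; for `j < 4` the subtraction `j - 3` truncates and the denominator is `1`. -/
theorem sum_div_one_add_shifted_sum_sq_le {c B : ℝ} (hc : 0 < c) {b : ℕ → ℝ} (hb : ∀ k, 0 ≤ b k)
    (hB : ∀ k < 4, b k ≤ B) (N : ℕ) :
    ∑ j ∈ Finset.range N, b j / (1 + c * ∑ l ∈ Finset.range (j - 3), b (l + 4)) ^ 2 ≤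
      4 * B + c⁻¹ := by
  have hn : ∀ j, 0 ≤ b j / (1 + c * ∑ l ∈ Finset.range (j - 3), b (l + 4)) ^ 2 :=
    fun j => div_nonneg (hb j) (sq_nonneg _)
  calc _ ≤ ∑ j ∈ Finset.range (4 + N),
        b j / (1 + c * ∑ l ∈ Finset.range (j - 3), b (l + 4)) ^ 2 :=
        Finset.sum_le_sum_of_subset_of_nonneg (Finset.range_mono (by omega)) fun j _ _ => hn j
    _ ≤ 4 * B + c⁻¹ := by
      rw [Finset.sum_range_add]
      refine add_le_add ?_ ?_
      · simp only [Finset.sum_range_succ, Finset.range_zero, Finset.sum_empty]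
        norm_num
        have := hB 0 (by norm_num); have := hB 1 (by norm_num)
        have := hB 2 (by norm_num); have := hB 3 (by norm_num)
        linarith
      · have h := sum_div_one_add_sum_sq_le hc (b := fun k => b (k + 4)) (fun k => hb _) N
        simp only [add_comm 4]
        refine h.trans ?_
        have : 0 ≤ (1 + c * ∑ l ∈ Finset.range N, b (l + 4))⁻¹ := by
          have := Finset.sum_nonneg fun k (_ : k ∈ Finset.range N) => hb (k + 4)
          positivity
        have hc' : 0 < c⁻¹ := by positivity
        nlinarith

/-! ### Smoothing at a given scale -/

/-- A bounded measurable function can be averaged at scale `δ` to a smooth function `g` whose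
values and gradient at `x` are controlled by the values of the function on the ball of radius
`δ / 2` about `x`, uniformly in `δ`. -/
theorem exists_smoothing (E : Type*) [NormedAddCommGroup E] [InnerProductSpace ℝ E]
    [FiniteDimensional ℝ E] [MeasurableSpace E] [BorelSpace E] :
    ∃ C : ℝ, 0 < C ∧ ∀ (δ : ℝ) (F : E → ℝ) (M : ℝ), 0 < δ → Measurable F → (∀ x, 0 ≤ F x) →
      (∀ x, F x ≤ M) → ∃ g : E → ℝ, ContDiff ℝ ((⊤ : ℕ∞) : WithTop ℕ∞) g ∧
        (∀ x a, (∀ z, dist z x ≤ δ / 2 → a ≤ F z) → a ≤ g x) ∧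
        (∀ x b, (∀ z, dist z x ≤ δ / 2 → F z ≤ b) → g x ≤ b) ∧
        (∀ x b, (∀ z, dist z x ≤ δ / 2 → F z ≤ b) → ‖fderiv ℝ g x‖ ≤ C / δ * b) := by
  let φ : ContDiffBump (0 : E) := ⟨1 / 4, 1 / 2, by norm_num, by norm_num⟩
  set η : E → ℝ := φ.normed volume with hη
  have hηc : HasCompactSupport η := φ.hasCompactSupport_normed
  have hηs : ContDiff ℝ ((⊤ : ℕ∞) : WithTop ℕ∞) η := φ.contDiff_normed
  have hη0 : ∀ x, 0 ≤ η x := φ.nonneg_normed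
  have hηi : Integrable η := φ.integrable_normed
  have hη1 : ∫ x, η x = 1 := φ.integral_normed
  have hsupp : ∀ t, η t ≠ 0 → ‖t‖ ≤ 1 / 2 := fun t ht => by
    have : t ∈ Function.support η := ht
    rw [hη, φ.support_normed_eq] at this
    exact (mem_ball_zero_iff.1 this).le
  have hdsupp : ∀ t, fderiv ℝ η t ≠ 0 → ‖t‖ ≤ 1 / 2 := fun t ht => by
    have : t ∈ tsupport η := support_fderiv_subset ℝ ht
    rw [hη, φ.tsupport_normed_eq] at this
    exact mem_closedBall_zero_iff.1 this
  have hdi : Integrable (fderiv ℝ η) :=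
    (hηs.continuous_fderiv (by simp)).integrable_of_hasCompactSupport (hηc.fderiv ℝ)
  have hI0 : 0 ≤ ∫ t, ‖fderiv ℝ η t‖ := integral_nonneg fun _ => norm_nonneg _
  refine ⟨(∫ t, ‖fderiv ℝ η t‖) + 1, by linarith, fun δ F M hδ hF hF0 hFM => ?_⟩
  -- `G` is `F` in coordinates in which the scale `δ` becomes `1`.
  set G : E → ℝ := fun y => F (δ • y)
  have hGm : Measurable G := hF.comp (measurable_const_smul δ)
  have hGl : LocallyIntegrable G (volume : Measure E) := by
    refine (locallyIntegrable_const M).mono hGm.aestronglyMeasurable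
      (Filter.Eventually.of_forall ?_)
    intro y
    rw [Real.norm_of_nonneg (hF0 _)]
    exact (hFM _).trans (le_abs_self M)
  -- In these coordinates the support of `η` corresponds to the ball of radius `δ / 2`.
  have hnear : ∀ (x t : E), ‖t‖ ≤ 1 / 2 → dist (δ • (δ⁻¹ • x - t)) x ≤ δ / 2 := by
    intro x t ht
    rw [smul_sub, smul_inv_smul₀ hδ.ne', dist_eq_norm, sub_sub_cancel_left, norm_neg, norm_smul,
      Real.norm_of_nonneg hδ.le]
    nlinarith
  have hint : ∀ y, Integrable (fun t => η t * G (y - t)) := fun y => by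
    refine hηi.mul_bdd (c := M) (hGm.comp (measurable_const.sub measurable_id)).aestronglyMeasurable
      (Filter.Eventually.of_forall fun t => ?_)
    rw [Real.norm_of_nonneg (hF0 _)]; exact hFM _
  set L := ContinuousLinearMap.lsmul ℝ ℝ (E := ℝ) with hL
  set c : E → ℝ := MeasureTheory.convolution η G L volume
  have hcv : ∀ y, c y = ∫ t, η t * G (y - t) := fun y => rfl
  have hcs : ContDiff ℝ ((⊤ : ℕ∞) : WithTop ℕ∞) c := hηc.contDiff_convolution_left L hηs hGl
  refine ⟨fun x => c (δ⁻¹ • x), hcs.comp (contDiff_const_smul _), fun x a ha => ?_,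
    fun x b hb => ?_, fun x b hb => ?_⟩
  · show a ≤ c (δ⁻¹ • x)
    rw [hcv]
    calc a = ∫ t, η t * a := by rw [integral_mul_const, hη1, one_mul]
      _ ≤ _ := by
        refine integral_mono (hηi.mul_const _) (hint _) fun t => ?_
        show η t * a ≤ η t * G (δ⁻¹ • x - t)
        by_cases ht : η t = 0
        · simp [ht]
        · exact mul_le_mul_of_nonneg_left (ha _ (hnear x t (hsupp t ht))) (hη0 t)
  · show c (δ⁻¹ • x) ≤ b
    rw [hcv]
    calc _ ≤ ∫ t, η t * b := by
          refine integral_mono (hint _) (hηi.mul_const _) fun t => ?_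
          show η t * G (δ⁻¹ • x - t) ≤ η t * b
          by_cases ht : η t = 0
          · simp [ht]
          · exact mul_le_mul_of_nonneg_left (hb _ (hnear x t (hsupp t ht))) (hη0 t)
      _ = b := by rw [integral_mul_const, hη1, one_mul]
  · have hb0 : 0 ≤ b := (hF0 x).trans (hb x (by simpa using by positivity))
    have hd := hηc.hasFDerivAt_convolution_left L (hηs.of_le (by simp)) hGl (δ⁻¹ • x)
    have hd' : HasFDerivAt (fun x => c (δ⁻¹ • x)) _ x :=
      hd.comp x ((hasFDerivAt_id x).const_smul δ⁻¹)
    rw [hd'.fderiv]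
    have hn : ‖(MeasureTheory.convolution (fderiv ℝ η) G (L.precompL E) volume) (δ⁻¹ • x)‖
        ≤ (∫ t, ‖fderiv ℝ η t‖) * b := by
      rw [← integral_mul_const]
      refine norm_integral_le_of_norm_le (hdi.norm.mul_const b) (Filter.Eventually.of_forall ?_)
      intro t
      by_cases ht : fderiv ℝ η t = 0
      · simp [ht]
      · have h1 : (L.precompL E (fderiv ℝ η t)) (G (δ⁻¹ • x - t))
            = G (δ⁻¹ • x - t) • fderiv ℝ η t := by
          ext v; simp [hL, mul_comm]
        rw [h1, norm_smul, Real.norm_of_nonneg (hF0 _), mul_comm]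
        exact mul_le_mul_of_nonneg_left (hb _ (hnear x t (hdsupp t ht))) (norm_nonneg _)
    refine (ContinuousLinearMap.opNorm_comp_le _ _).trans ?_
    have hid : ‖δ⁻¹ • ContinuousLinearMap.id ℝ E‖ ≤ δ⁻¹ := by
      rw [norm_smul, Real.norm_of_nonneg (by positivity)]
      exact mul_le_of_le_one_right (by positivity) ContinuousLinearMap.norm_id_le
    calc _ ≤ ((∫ t, ‖fderiv ℝ η t‖) * b) * δ⁻¹ :=
          mul_le_mul hn hid (norm_nonneg _) (by positivity)
      _ ≤ _ := by
        rw [div_mul_eq_mul_div, div_eq_mul_inv]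
        gcongr
        linarith

/-! ### Dyadic terms of the Wolff potential -/

/-- The term of scale `ρ / 2 ^ k` in the dyadic form of the Wolff potential of `ν` at `x`, as a real
number; it is meant for finite `ν`. -/
noncomputable def wolffTerm {n : ℕ} (p : ℝ) (ν : Measure (EuclideanSpace ℝ (Fin n))) (ρ : ℝ)
    (k : ℕ) (x : EuclideanSpace ℝ (Fin n)) : ℝ :=
  (ν.real (Metric.ball x (ρ / 2 ^ k)) / (ρ / 2 ^ k) ^ ((n : ℝ) - p)) ^ (1 / (p - 1))

/-- The constant `2 ^ ((n - p) / (p - 1))`: the factor that the power of the radius contributes when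
the scale in `wolffTerm` is halved. -/
noncomputable def wolffRatio (n : ℕ) (p : ℝ) : ℝ := (2 : ℝ) ^ (((n : ℝ) - p) / (p - 1))

theorem wolffRatio_pos (n : ℕ) (p : ℝ) : 0 < wolffRatio n p := by unfold wolffRatio; positivity

section

variable {n : ℕ} {p : ℝ} {ν : Measure (EuclideanSpace ℝ (Fin n))} {ρ : ℝ}

theorem wolffTerm_nonneg (hρ : 0 < ρ) (k : ℕ) (x : EuclideanSpace ℝ (Fin n)) :
    0 ≤ wolffTerm p ν ρ k x := by
  unfold wolffTerm; positivity

theorem measurable_measure_ball {X : Type*} [PseudoMetricSpace X] [SecondCountableTopology X]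
    [MeasurableSpace X] [OpensMeasurableSpace X] (ν : Measure X) [SFinite ν] (t : ℝ) :
    Measurable fun x => ν (Metric.ball x t) := by
  have h : MeasurableSet {q : X × X | dist q.2 q.1 < t} :=
    (isOpen_lt (continuous_snd.dist continuous_fst) continuous_const).measurableSet
  exact measurable_measure_prodMk_left h

theorem measurable_wolffTerm [IsFiniteMeasure ν] (k : ℕ) : Measurable (wolffTerm p ν ρ k) :=
  (((measurable_measure_ball ν _).ennreal_toReal).div_const _).pow_const _

theorem wolffTerm_le [IsFiniteMeasure ν] (hp : 1 < p) (hρ : 0 < ρ) (k : ℕ)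
    (x : EuclideanSpace ℝ (Fin n)) :
    wolffTerm p ν ρ k x ≤ (ν.real univ / (ρ / 2 ^ k) ^ ((n : ℝ) - p)) ^ (1 / (p - 1)) := by
  unfold wolffTerm
  have : 0 < p - 1 := by linarith
  gcongr
  · exact measure_ne_top ν _
  · exact subset_univ _

/-- Holds because `B(x, ρ / 2 ^ (k + 1)) ⊆ B(y, ρ / 2 ^ k)`. -/
theorem wolffTerm_succ_le [IsFiniteMeasure ν] (hp : 1 < p) (hρ : 0 < ρ) {k : ℕ}
    {x y : EuclideanSpace ℝ (Fin n)} (h : dist x y ≤ ρ / 2 ^ (k + 1)) :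
    wolffTerm p ν ρ (k + 1) x ≤ wolffRatio n p * wolffTerm p ν ρ k y := by
  unfold wolffTerm wolffRatio
  have hp' : 0 < p - 1 := by linarith
  have hsub : Metric.ball x (ρ / 2 ^ (k + 1)) ⊆ Metric.ball y (ρ / 2 ^ k) := by
    refine Metric.ball_subset_ball' ?_
    have : ρ / 2 ^ k = ρ / 2 ^ (k + 1) + ρ / 2 ^ (k + 1) := by rw [pow_succ]; field_simp; norm_num
    linarith
  have e : (2 : ℝ) ^ (((n : ℝ) - p) / (p - 1)) = ((2 : ℝ) ^ ((n : ℝ) - p)) ^ (1 / (p - 1)) := by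
    rw [← Real.rpow_mul (by norm_num)]; congr 1; ring
  rw [e, ← Real.mul_rpow (by positivity) (by positivity)]
  refine Real.rpow_le_rpow (by positivity) ?_ (by positivity)
  have e2 : (ρ / 2 ^ k) ^ ((n : ℝ) - p) =
      2 ^ ((n : ℝ) - p) * (ρ / 2 ^ (k + 1)) ^ ((n : ℝ) - p) := by
    rw [← Real.mul_rpow (by norm_num) (by positivity)]; congr 1; rw [pow_succ]; field_simp
  rw [e2]
  rw [← mul_div_assoc, mul_div_mul_left _ _ (by positivity)]
  gcongr
  exact measure_ne_top ν _

theorem wolffTerm_eq_zero (hp : 1 < p) {k : ℕ} {x : EuclideanSpace ℝ (Fin n)}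
    (h : ν (Metric.ball x (ρ / 2 ^ k)) = 0) : wolffTerm p ν ρ k x = 0 := by
  have hp' : 0 < p - 1 := by linarith
  rw [wolffTerm, Measure.real, h, ENNReal.toReal_zero, zero_div, Real.zero_rpow (by positivity)]

end

/-- Smooth functions comparable to the dyadic terms: `g k` is the average of
`wolffTerm p ν ρ (k + 2)` at scale `ρ / 2 ^ (k + 2)`. -/
theorem exists_smooth_wolffTerm (n : ℕ) {p : ℝ} (hp : 1 < p) :
    ∃ C : ℝ, 0 < C ∧ ∀ (ν : Measure (EuclideanSpace ℝ (Fin n))) [IsFiniteMeasure ν] (ρ : ℝ),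
      0 < ρ → ∃ g : ℕ → EuclideanSpace ℝ (Fin n) → ℝ, ∀ k,
        ContDiff ℝ ((⊤ : ℕ∞) : WithTop ℕ∞) (g k) ∧
        (∀ x, (wolffRatio n p)⁻¹ * wolffTerm p ν ρ (k + 3) x ≤ g k x) ∧
        (∀ x, ‖fderiv ℝ (g k) x‖ ≤ C * (2 ^ k / ρ * wolffTerm p ν ρ (k + 1) x)) ∧
        (∀ x, ν (Metric.ball x (ρ / 2)) = 0 → g k x = 0) := by
  obtain ⟨C, hC, h⟩ := exists_smoothing (EuclideanSpace ℝ (Fin n))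
  have hκ := wolffRatio_pos n p
  refine ⟨C * 4 * wolffRatio n p, by positivity, fun ν _ ρ hρ => ?_⟩
  choose g hg1 hg2 hg3 hg4 using fun k : ℕ => h (ρ / 2 ^ (k + 2)) (wolffTerm p ν ρ (k + 2)) _
    (by positivity) (measurable_wolffTerm _) (wolffTerm_nonneg hρ _) (wolffTerm_le hp hρ _)
  have e : ∀ k : ℕ, ρ / 2 ^ (k + 2) / 2 = ρ / 2 ^ (k + 3) := fun k => by
    rw [pow_succ _ (k + 2)]; field_simp
  refine ⟨g, fun k => ⟨hg1 k, fun x => hg2 k x _ fun z hz => ?_, fun x => ?_, fun x hx => ?_⟩⟩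
  · rw [inv_mul_le_iff₀ hκ]
    refine wolffTerm_succ_le hp hρ ?_
    rwa [dist_comm, ← e]
  · refine (hg4 k x (wolffRatio n p * wolffTerm p ν ρ (k + 1) x) fun z hz => ?_).trans
      (le_of_eq ?_)
    · exact wolffTerm_succ_le hp hρ (hz.trans (half_le_self (by positivity)))
    · rw [pow_add]; field_simp; norm_num [mul_comm]
  · have hz : ∀ z, dist z x ≤ ρ / 2 ^ (k + 2) / 2 → wolffTerm p ν ρ (k + 2) z = 0 := by
      intro z hz
      refine wolffTerm_eq_zero hp (measure_mono_null (Metric.ball_subset_ball' ?_) hx)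
      have : ρ / 2 ^ (k + 2) ≤ ρ / 4 := by
        rw [pow_add]
        gcongr
        have : (1 : ℝ) ≤ 2 ^ k := one_le_pow₀ (by norm_num)
        linarith
      linarith
    exact le_antisymm (hg3 k x 0 fun z h => (hz z h).le) (hg2 k x 0 fun z h => (hz z h).ge)

/-- Fubini: an integral against the density `y ↦ ν(B(y, t))` is an integral with respect to `ν` of
integrals over balls of radius `t`. -/
theorem lintegral_measure_ball_mul_le {n : ℕ} (ν : Measure (EuclideanSpace ℝ (Fin n)))
    [IsFiniteMeasure ν] {t : ℝ} {Ψ Ψ' : EuclideanSpace ℝ (Fin n) → ℝ≥0∞} (hΨ : Measurable Ψ)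
    (h : ∀ x y, dist x y < t → Ψ y ≤ Ψ' x) :
    ∫⁻ y, ν (Metric.ball y t) * Ψ y ≤
      volume (Metric.ball (0 : EuclideanSpace ℝ (Fin n)) t) * ∫⁻ x, Ψ' x ∂ν := by
  have hm : Measurable (Function.uncurry fun y x : EuclideanSpace ℝ (Fin n) =>
      (Metric.ball y t).indicator (fun _ => Ψ y) x) := by
    have hs : MeasurableSet
        {q : EuclideanSpace ℝ (Fin n) × EuclideanSpace ℝ (Fin n) | dist q.2 q.1 < t} :=
      (isOpen_lt (continuous_snd.dist continuous_fst) continuous_const).measurableSet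
    exact (hΨ.comp measurable_fst).indicator hs
  calc ∫⁻ y, ν (Metric.ball y t) * Ψ y
      = ∫⁻ y, ∫⁻ x, (Metric.ball y t).indicator (fun _ => Ψ y) x ∂ν := by
        refine lintegral_congr fun y => ?_
        rw [lintegral_indicator_const Metric.isOpen_ball.measurableSet, mul_comm]
    _ = ∫⁻ x, (∫⁻ y, (Metric.ball y t).indicator (fun _ => Ψ y) x) ∂ν :=
        lintegral_lintegral_swap hm.aemeasurable
    _ ≤ ∫⁻ x, volume (Metric.ball (0 : EuclideanSpace ℝ (Fin n)) t) * Ψ' x ∂ν := by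
        refine lintegral_mono fun x => ?_
        calc _ ≤ ∫⁻ y, (Metric.ball x t).indicator (fun _ => Ψ' x) y := by
              refine lintegral_mono fun y => ?_
              by_cases hxy : dist x y < t
              · rw [indicator_of_mem (by simpa using hxy),
                  indicator_of_mem (by simpa [dist_comm] using hxy)]
                exact h x y hxy
              · rw [indicator_of_notMem (by simpa using hxy)]; exact zero_le
          _ = _ := by
              rw [lintegral_indicator_const Metric.isOpen_ball.measurableSet, mul_comm,
                Measure.addHaar_ball_center]
    _ = _ := lintegral_const_mul' _ _ measure_ball_lt_top.ne

/-! ### The energy estimate -/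

set_option maxHeartbeats 400000 in
/-- One product of the expansion of `(∑ A_k) ^ p`, with scales `j` and `j + k`. The factor
`A_{j+k} ^ (p - 1)` is a multiple of `ν(B(y, ρ / 2 ^ (j + k + 1)))`, and integrating over balls of
that radius gains `2 ^ (-k)` over the coarser scale `j`, which absorbs the weight `(3 / 2) ^ k`. -/
theorem lintegral_wolffTerm_mul_le {n : ℕ} {p : ℝ} (hp : 2 ≤ p)
    (ν : Measure (EuclideanSpace ℝ (Fin n))) [IsFiniteMeasure ν] {ρ : ℝ} (hρ : 0 < ρ)
    {N j k : ℕ} (hjk : j + k < N) :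
    ∫⁻ y, ENNReal.ofReal ((3 / 2) ^ k *
        ((2 ^ (j + k) / ρ * wolffTerm p ν ρ (j + k + 1) y) ^ (p - 1) *
          (2 ^ j / ρ * wolffTerm p ν ρ (j + 1) y)) /
        (1 + (wolffRatio n p)⁻¹ * ∑ i ∈ Finset.range N, wolffTerm p ν ρ (i + 3) y) ^ 2) ≤
      ENNReal.ofReal (wolffRatio n p * (3 / 4) ^ k) *
        (volume (Metric.ball (0 : EuclideanSpace ℝ (Fin n)) 1) *
        ∫⁻ x, ENNReal.ofReal (wolffTerm p ν ρ j x /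
          (1 + (wolffRatio n p ^ 2)⁻¹ *
            ∑ l ∈ Finset.range (j - 3), wolffTerm p ν ρ (l + 4) x) ^ 2) ∂ν) := by
  have hκ := wolffRatio_pos n p
  set κ := wolffRatio n p
  set σ : ℝ := ρ / 2 ^ (j + k + 1) with hσ
  have hσ0 : 0 < σ := by positivity
  set D := wolffTerm p ν ρ with hD
  have hD0 : ∀ k x, 0 ≤ D k x := fun k x => wolffTerm_nonneg hρ k x
  have hp1 : 1 < p := by linarith
  have hσle : ∀ i, i ≤ j + k + 1 → σ ≤ ρ / 2 ^ i := fun i hi =>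
    div_le_div_of_nonneg_left hρ.le (by positivity) (pow_le_pow_right₀ one_le_two hi)
  set T : EuclideanSpace ℝ (Fin n) → ℝ := fun x =>
    D j x / (1 + (κ ^ 2)⁻¹ * ∑ l ∈ Finset.range (j - 3), D (l + 4) x) ^ 2 with hT
  set Ψ : EuclideanSpace ℝ (Fin n) → ℝ := fun y => D (j + 1) y /
    (1 + κ⁻¹ * ∑ i ∈ Finset.range N, D (i + 3) y) ^ 2 with hΨ
  have hΨm : Measurable Ψ := by
    refine (measurable_wolffTerm _).div (((Measurable.const_mul ?_ _).const_add _).pow_const _)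
    exact Finset.measurable_sum _ fun i _ => measurable_wolffTerm _
  -- On balls of radius `σ` the weight is controlled by its value at the centre.
  have hΨT : ∀ x y, dist x y < σ → Ψ y ≤ κ * T x := by
    intro x y hxy
    have h1 : D (j + 1) y ≤ κ * D j x := by
      refine wolffTerm_succ_le hp1 hρ ((dist_comm y x).trans_le (hxy.le.trans ?_))
      exact hσle _ (by omega)
    have h2 : ∑ l ∈ Finset.range (j - 3), κ⁻¹ * D (l + 4) x ≤
        ∑ i ∈ Finset.range N, D (i + 3) y := by
      refine (Finset.sum_le_sum fun l hl => ?_).trans (Finset.sum_le_sum_of_subset_of_nonneg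
        (Finset.range_mono (by omega : j - 3 ≤ N)) fun i _ _ => hD0 _ _)
      rw [inv_mul_le_iff₀ hκ]
      refine wolffTerm_succ_le hp1 hρ (hxy.le.trans ?_)
      have := Finset.mem_range.1 hl
      exact hσle _ (by omega)
    have h3 : (κ ^ 2)⁻¹ * ∑ l ∈ Finset.range (j - 3), D (l + 4) x ≤
        κ⁻¹ * ∑ i ∈ Finset.range N, D (i + 3) y := by
      rw [← Finset.mul_sum] at h2
      rw [pow_two, mul_inv, mul_assoc]
      gcongr
    have h4 : 0 ≤ (κ ^ 2)⁻¹ * ∑ l ∈ Finset.range (j - 3), D (l + 4) x :=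
      mul_nonneg (by positivity) (Finset.sum_nonneg fun _ _ => hD0 _ _)
    simp only [hΨ, hT, ← mul_div_assoc]
    exact div_le_div₀ (mul_nonneg hκ.le (hD0 j x)) h1 (by positivity)
      (pow_le_pow_left₀ (by linarith) (by linarith) 2)
  set c : ℝ := (3 / 2) ^ k * ((2 ^ (j + k) / ρ) ^ (p - 1) / σ ^ ((n : ℝ) - p) * (2 ^ j / ρ)) with hc
  have hc0 : 0 ≤ c := by positivity
  -- The gain `2 ^ (-k)` beats the weight `(3 / 2) ^ k`.
  have hcκ : c * (σ ^ n * κ) ≤ κ * (3 / 4) ^ k := by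
    have e1 : (2 : ℝ) ^ (j + k) / ρ = (2 * σ)⁻¹ := by
      rw [hσ, pow_succ]; field_simp
    have e2 : (2 : ℝ) ^ j / ρ = (2 ^ k * (2 * σ))⁻¹ := by
      rw [hσ, pow_succ, pow_add]; field_simp
    have e3 : (2 * σ)⁻¹ ^ (p - 1) ≤ σ ^ (-(p - 1)) := by
      rw [Real.inv_rpow (by positivity), ← Real.rpow_neg (by positivity)]
      exact Real.rpow_le_rpow_of_nonpos hσ0 (by linarith) (by linarith)
    have e4 : σ ^ (-(p - 1)) / σ ^ ((n : ℝ) - p) * σ ^ n = σ := by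
      rw [← Real.rpow_natCast σ n, ← Real.rpow_sub hσ0, ← Real.rpow_add hσ0]
      ring_nf; exact Real.rpow_one σ
    calc c * (σ ^ n * κ) = (3 / 2) ^ k * ((2 * σ)⁻¹ ^ (p - 1) / σ ^ ((n : ℝ) - p) * σ ^ n) *
          (2 ^ k * (2 * σ))⁻¹ * κ := by rw [hc, e1, e2]; ring
      _ ≤ (3 / 2) ^ k * (σ ^ (-(p - 1)) / σ ^ ((n : ℝ) - p) * σ ^ n) *
          (2 ^ k * (2 * σ))⁻¹ * κ := by gcongr
      _ = (3 / 4) ^ k * (κ / 2) := by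
        rw [e4, show (3 / 4 : ℝ) = 3 / 2 / 2 by norm_num, div_pow (3 / 2 : ℝ)]; field_simp
      _ ≤ κ * (3 / 4) ^ k := by
        rw [mul_comm]; gcongr; linarith
  -- The exponent `p - 1` undoes the root in `wolffTerm`, which leaves the measure of a ball.
  have hpt : ∀ y, ENNReal.ofReal ((3 / 2) ^ k *
        ((2 ^ (j + k) / ρ * D (j + k + 1) y) ^ (p - 1) * (2 ^ j / ρ * D (j + 1) y)) /
        (1 + κ⁻¹ * ∑ i ∈ Finset.range N, D (i + 3) y) ^ 2) =
      ENNReal.ofReal c * (ν (Metric.ball y σ) * ENNReal.ofReal (Ψ y)) := by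
    intro y
    have e : D (j + k + 1) y ^ (p - 1) = ν.real (Metric.ball y σ) / σ ^ ((n : ℝ) - p) := by
      simp only [hD, wolffTerm, ← hσ]
      rw [← Real.rpow_mul (by positivity), one_div_mul_cancel (by linarith), Real.rpow_one]
    rw [← ofReal_measureReal (measure_ne_top ν _), ← ENNReal.ofReal_mul measureReal_nonneg,
      ← ENNReal.ofReal_mul hc0, Real.mul_rpow (by positivity) (hD0 _ _), e]
    congr 1
    simp only [hΨ, hc]; ring
  have hvol : volume (Metric.ball (0 : EuclideanSpace ℝ (Fin n)) σ) =
      ENNReal.ofReal (σ ^ n) * volume (Metric.ball (0 : EuclideanSpace ℝ (Fin n)) 1) := by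
    rw [Measure.addHaar_ball_of_pos _ _ hσ0]; simp
  calc _ = ENNReal.ofReal c * ∫⁻ y, ν (Metric.ball y σ) * ENNReal.ofReal (Ψ y) := by
        rw [← lintegral_const_mul' _ _ ENNReal.ofReal_ne_top]
        exact lintegral_congr hpt
    _ ≤ ENNReal.ofReal c * (volume (Metric.ball (0 : EuclideanSpace ℝ (Fin n)) σ) *
        ∫⁻ x, ENNReal.ofReal κ * ENNReal.ofReal (T x) ∂ν) := by
        gcongr
        refine lintegral_measure_ball_mul_le ν hΨm.ennreal_ofReal fun x y hxy => ?_
        rw [← ENNReal.ofReal_mul hκ.le]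
        exact ENNReal.ofReal_le_ofReal (hΨT x y hxy)
    _ = ENNReal.ofReal (c * (σ ^ n * κ)) *
        (volume (Metric.ball (0 : EuclideanSpace ℝ (Fin n)) 1) *
          ∫⁻ x, ENNReal.ofReal (T x) ∂ν) := by
        rw [lintegral_const_mul' _ _ ENNReal.ofReal_ne_top, hvol,
          ENNReal.ofReal_mul (p := c) hc0, ENNReal.ofReal_mul (p := σ ^ n) (by positivity)]
        ring
    _ ≤ _ := by gcongr

set_option maxHeartbeats 400000 in
/-- The energy estimate behind the weak-type bound; the first four dyadic terms, which the
denominator does not control, enter through their bound `B`. -/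
theorem exists_lintegral_sum_wolffTerm_rpow_le (n : ℕ) {p : ℝ} (hp : 2 ≤ p) :
    ∃ C : ℝ, 0 < C ∧ ∀ (ν : Measure (EuclideanSpace ℝ (Fin n))) [IsFiniteMeasure ν] (ρ B : ℝ),
      0 < ρ → (∀ k < 4, ∀ x, wolffTerm p ν ρ k x ≤ B) → ∀ N : ℕ,
      ∫⁻ y, ENNReal.ofReal ((∑ k ∈ Finset.range N, 2 ^ k / ρ * wolffTerm p ν ρ (k + 1) y) ^ p /
        (1 + (wolffRatio n p)⁻¹ * ∑ i ∈ Finset.range N, wolffTerm p ν ρ (i + 3) y) ^ 2) ≤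
      ENNReal.ofReal (C * (4 * B + wolffRatio n p ^ 2)) * ν univ := by
  obtain ⟨C, hC, h⟩ := exists_sum_rpow_le_sum_mul hp
  have hκ := wolffRatio_pos n p
  set κ := wolffRatio n p
  set V := volume (Metric.ball (0 : EuclideanSpace ℝ (Fin n)) 1)
  have hVt : V ≠ ∞ := measure_ball_lt_top.ne
  have hV0 : V ≠ 0 := (Metric.measure_ball_pos _ _ one_pos).ne'
  refine ⟨C * (4 * κ) * V.toReal, mul_pos (by positivity) (ENNReal.toReal_pos hV0 hVt),
    fun ν _ ρ B hρ hB N => ?_⟩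
  set D := wolffTerm p ν ρ
  have hD0 : ∀ k x, 0 ≤ D k x := fun k x => wolffTerm_nonneg hρ k x
  have hDm : ∀ k, Measurable (D k) := fun k => measurable_wolffTerm k
  set S : EuclideanSpace ℝ (Fin n) → ℝ := fun y => 1 + κ⁻¹ * ∑ i ∈ Finset.range N, D (i + 3) y
  have hSm : Measurable S :=
    ((Finset.measurable_sum _ fun i _ => hDm _).const_mul _).const_add _
  set T : ℕ → EuclideanSpace ℝ (Fin n) → ℝ := fun j x =>
    D j x / (1 + (κ ^ 2)⁻¹ * ∑ l ∈ Finset.range (j - 3), D (l + 4) x) ^ 2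
  have hT0 : ∀ j x, 0 ≤ T j x := fun j x => div_nonneg (hD0 _ _) (sq_nonneg _)
  have hTm : ∀ j, Measurable (T j) := fun j => (hDm j).div
    ((((Finset.measurable_sum _ fun i _ => hDm _).const_mul _).const_add _).pow_const _)
  set a : ℕ → ℕ → EuclideanSpace ℝ (Fin n) → ℝ := fun j k y => (3 / 2) ^ k *
      ((2 ^ (j + k) / ρ * D (j + k + 1) y) ^ (p - 1) * (2 ^ j / ρ * D (j + 1) y)) / S y ^ 2 with ha
  have ha0 : ∀ j k y, 0 ≤ a j k y := fun j k y => by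
    have h1 := mul_nonneg (by positivity : 0 ≤ (2 : ℝ) ^ (j + k) / ρ) (hD0 (j + k + 1) y)
    have h2 := mul_nonneg (by positivity : 0 ≤ (2 : ℝ) ^ j / ρ) (hD0 (j + 1) y)
    exact div_nonneg (mul_nonneg (by positivity) (mul_nonneg (Real.rpow_nonneg h1 _) h2))
      (sq_nonneg _)
  have ham : ∀ j k, Measurable (a j k) := fun j k => by
    have h1 := hDm (j + k + 1)
    have h2 := hDm (j + 1)
    simp only [ha]
    fun_prop
  have hgeom : ∀ M : ℕ, ∑ k ∈ Finset.range M, κ * (3 / 4 : ℝ) ^ k ≤ 4 * κ := fun M => by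
    rw [← Finset.mul_sum, mul_comm]
    gcongr
    have := (summable_geometric_of_lt_one (by norm_num) (by norm_num : (3 / 4 : ℝ) < 1)).sum_le_tsum
      (Finset.range M) fun _ _ => by positivity
    rw [tsum_geometric_of_lt_one (by norm_num) (by norm_num)] at this
    norm_num at this; exact this
  calc _ ≤ ∫⁻ y, ENNReal.ofReal C * ∑ j ∈ Finset.range N, ∑ k ∈ Finset.range (N - j),
          ENNReal.ofReal (a j k y) := by
        refine lintegral_mono fun y => ?_
        have e : ∑ j ∈ Finset.range N, ∑ k ∈ Finset.range (N - j), ENNReal.ofReal (a j k y) =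
            ENNReal.ofReal (∑ j ∈ Finset.range N, ∑ k ∈ Finset.range (N - j), a j k y) := by
          rw [ENNReal.ofReal_sum_of_nonneg fun j _ => Finset.sum_nonneg fun k _ => ha0 j k y]
          exact Finset.sum_congr rfl fun j _ =>
            (ENNReal.ofReal_sum_of_nonneg fun k _ => ha0 j k y).symm
        rw [e, ← ENNReal.ofReal_mul hC.le]
        refine ENNReal.ofReal_le_ofReal ?_
        have := h N (fun k => 2 ^ k / ρ * D (k + 1) y) fun k => mul_nonneg (by positivity) (hD0 _ _)
        simp only [ha, ← Finset.sum_div, ← mul_div_assoc]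
        exact div_le_div_of_nonneg_right this (sq_nonneg _)
    _ = ENNReal.ofReal C * ∑ j ∈ Finset.range N, ∑ k ∈ Finset.range (N - j),
          ∫⁻ y, ENNReal.ofReal (a j k y) := by
        rw [lintegral_const_mul' _ _ ENNReal.ofReal_ne_top, lintegral_finsetSum _ fun j _ =>
          Finset.measurable_sum _ fun k _ => (ham j k).ennreal_ofReal]
        congr 1
        exact Finset.sum_congr rfl fun j _ => lintegral_finsetSum _ fun k _ =>
          (ham j k).ennreal_ofReal
    _ ≤ ENNReal.ofReal C * ∑ j ∈ Finset.range N, ∑ k ∈ Finset.range (N - j),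
          ENNReal.ofReal (κ * (3 / 4) ^ k) * (V * ∫⁻ x, ENNReal.ofReal (T j x) ∂ν) := by
        gcongr with j hj k hk
        have := Finset.mem_range.1 hj
        have := Finset.mem_range.1 hk
        exact lintegral_wolffTerm_mul_le hp ν hρ (by omega)
    _ ≤ ENNReal.ofReal C * ∑ j ∈ Finset.range N,
          ENNReal.ofReal (4 * κ) * (V * ∫⁻ x, ENNReal.ofReal (T j x) ∂ν) := by
        gcongr with j hj
        rw [← Finset.sum_mul, ← ENNReal.ofReal_sum_of_nonneg fun k _ => by positivity]
        gcongr
        exact hgeom _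
    _ = ENNReal.ofReal (C * (4 * κ)) *
          (V * ∫⁻ x, ENNReal.ofReal (∑ j ∈ Finset.range N, T j x) ∂ν) := by
        rw [← Finset.mul_sum, ← Finset.mul_sum, ← mul_assoc, ← ENNReal.ofReal_mul hC.le,
          ← lintegral_finsetSum _ fun j _ => (hTm j).ennreal_ofReal]
        congr 3
        funext x
        rw [ENNReal.ofReal_sum_of_nonneg fun j _ => hT0 j x]
    _ ≤ ENNReal.ofReal (C * (4 * κ)) * (V * ∫⁻ _, ENNReal.ofReal (4 * B + κ ^ 2) ∂ν) := by
        gcongr with x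
        have := sum_div_one_add_shifted_sum_sq_le (c := (κ ^ 2)⁻¹) (by positivity)
          (fun k => hD0 k x) (fun k hk => hB k hk x) N
        rwa [inv_inv] at this
    _ = _ := by
        rw [lintegral_const, ENNReal.ofReal_mul (by positivity : 0 ≤ C * (4 * κ) * V.toReal),
          ENNReal.ofReal_mul (by positivity : 0 ≤ C * (4 * κ)), ENNReal.ofReal_toReal hVt]
        ring

/-! ### Upper bound for the capacity of superlevel sets -/

theorem norm_gradient {E : Type*} [NormedAddCommGroup E] [InnerProductSpace ℝ E] [CompleteSpace E]
    (u : E → ℝ) (x : E) : ‖gradient u x‖ = ‖fderiv ℝ u x‖ := by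
  rw [gradient, LinearIsometryEquiv.norm_map]

/-- Weak-type capacity estimate: a set on which the dyadic Wolff potential of `ν` exceeds
`wolffRatio n p * l` has capacity at most `C ν(ℝⁿ) / log (1 + l) ^ p`, provided that `ν` lives
well inside `U`. -/
theorem exists_pCapacity_le (n : ℕ) {p : ℝ} (hp : 2 ≤ p) :
    ∃ C : ℝ, 0 < C ∧ ∀ (ν : Measure (EuclideanSpace ℝ (Fin n))) [IsFiniteMeasure ν] (ρ B l : ℝ)
      (K₀ U S : Set (EuclideanSpace ℝ (Fin n))), 0 < ρ →
      (∀ k < 4, ∀ x, wolffTerm p ν ρ k x ≤ B) → 0 < l → IsCompact K₀ → K₀ ⊆ U →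
      (∀ x, ν (Metric.ball x (ρ / 2)) ≠ 0 → x ∈ K₀) →
      (∀ x ∈ S, ∃ N : ℕ, wolffRatio n p * l < ∑ k ∈ Finset.range N, wolffTerm p ν ρ (k + 3) x) →
      pCapacity p S U ≤
        ENNReal.ofReal (C * (4 * B + wolffRatio n p ^ 2) / Real.log (1 + l) ^ p) * ν univ := by
  obtain ⟨C₁, hC₁, henergy⟩ := exists_lintegral_sum_wolffTerm_rpow_le n hp
  obtain ⟨C₂, hC₂, hsmooth⟩ := exists_smooth_wolffTerm n (p := p) (by linarith)
  have hκ := wolffRatio_pos n p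
  set κ := wolffRatio n p
  refine ⟨C₂ ^ p * C₁, by positivity, fun ν _ ρ B l K₀ U S hρ hB hl hK₀ hKU hν hS => ?_⟩
  obtain ⟨g, hg⟩ := hsmooth ν ρ hρ
  set D := wolffTerm p ν ρ
  have hD0 : ∀ k x, 0 ≤ D k x := fun k x => wolffTerm_nonneg hρ k x
  have hg0 : ∀ k x, 0 ≤ g k x := fun k x =>
    (mul_nonneg (by positivity) (hD0 _ _)).trans ((hg k).2.1 x)
  set w : ℕ → EuclideanSpace ℝ (Fin n) → ℝ := fun N x => ∑ k ∈ Finset.range N, g k x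
  have hw0 : ∀ N x, 0 ≤ w N x := fun N x => Finset.sum_nonneg fun k _ => hg0 k x
  have hwD : ∀ N x, κ⁻¹ * ∑ k ∈ Finset.range N, D (k + 3) x ≤ w N x := fun N x => by
    rw [Finset.mul_sum]; exact Finset.sum_le_sum fun k _ => (hg k).2.1 x
  have hws : ∀ N, ContDiff ℝ ((⊤ : ℕ∞) : WithTop ℕ∞) (w N) := fun N =>
    ContDiff.sum fun k _ => (hg k).1
  have hwz : ∀ N x, x ∉ K₀ → w N x = 0 := fun N x hx =>
    Finset.sum_eq_zero fun k _ => (hg k).2.2.2 x (by by_contra h; exact hx (hν x h))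
  have hwmono : ∀ x, Monotone fun N => w N x := fun x M N hMN =>
    Finset.sum_le_sum_of_subset_of_nonneg (Finset.range_mono hMN) fun k _ _ => hg0 k x
  have hopen : ∀ N, IsOpen {x | l < w N x} := fun N =>
    isOpen_lt continuous_const (hws N).continuous
  have hlog : 0 < Real.log (1 + l) := Real.log_pos (by linarith)
  -- The increasing union of the superlevel sets of the partial sums is the competing open set.
  have hSG : S ⊆ ⋃ N, {x | l < w N x} := fun x hx => by
    obtain ⟨N, hN⟩ := hS x hx
    refine mem_iUnion.2 ⟨N, lt_of_lt_of_le ?_ (hwD N x)⟩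
    rwa [inv_mul_eq_div, lt_div_iff₀' hκ]
  have hGU : ⋃ N, {x | l < w N x} ⊆ U := iUnion_subset fun N x (hx : l < w N x) => hKU <| by
    by_contra h
    rw [hwz N x h] at hx
    linarith
  have hcompact : ∀ K, IsCompact K ∧ K ⊆ ⋃ N, {x | l < w N x} → pCapacityCompact p K U ≤
      ENNReal.ofReal (C₂ ^ p * C₁ * (4 * B + κ ^ 2) / Real.log (1 + l) ^ p) * ν univ := by
    intro K hK
    obtain ⟨N, hN⟩ := hK.1.elim_directed_cover _ hopen hK.2
      (directed_of_isDirected_le fun M N hMN x (hx : l < w M x) => hx.trans_le (hwmono x hMN))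
    set v : EuclideanSpace ℝ (Fin n) → ℝ :=
      fun x => (Real.log (1 + l))⁻¹ * Real.log (1 + w N x) with hv
    have hpos : ∀ x, 0 < 1 + w N x := fun x => by have := hw0 N x; linarith
    have hvz : ∀ x, x ∉ K₀ → v x = 0 := fun x hx => by simp [hv, hwz N x hx]
    have htest : IsCapacityTest K U v :=
      { smooth := contDiff_const.mul ((contDiff_const.add (hws N)).log fun x => (hpos x).ne')
        compactSupport := HasCompactSupport.intro hK₀ hvz
        support_subset := (closure_minimal (fun x hx => by
          by_contra h; exact hx (hvz x h)) hK₀.isClosed).trans hKU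
        one_le := fun x hx => by
          have : l < w N x := hN hx
          simp only [hv]
          rw [inv_mul_eq_div, one_le_div hlog]
          exact Real.log_le_log (by linarith) (by linarith) }
    refine (iInf₂_le v htest).trans ?_
    have hgrad : ∀ x, ‖gradient v x‖ ≤ (Real.log (1 + l))⁻¹ * ((1 + w N x)⁻¹ *
        (C₂ * ∑ k ∈ Finset.range N, 2 ^ k / ρ * D (k + 1) x)) := by
      intro x
      have hdk : ∀ k, HasFDerivAt (g k) (fderiv ℝ (g k) x) x := fun k =>
        (((hg k).1.differentiable (by simp)) x).hasFDerivAt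
      have hd : HasFDerivAt (w N) (∑ k ∈ Finset.range N, fderiv ℝ (g k) x) x :=
        HasFDerivAt.fun_sum fun k _ => hdk k
      have hd2 := (((hd.const_add 1).log (hpos x).ne').const_mul (Real.log (1 + l))⁻¹)
      rw [norm_gradient, hd2.fderiv, norm_smul, norm_smul, Real.norm_of_nonneg (by positivity),
        Real.norm_of_nonneg (by have := hpos x; positivity), Finset.mul_sum]
      have := hpos x
      gcongr
      exact (norm_sum_le _ _).trans (Finset.sum_le_sum fun k _ => (hg k).2.2.1 x)
    have hpt : ∀ x, ‖gradient v x‖ₑ ^ p ≤ ENNReal.ofReal (C₂ ^ p / Real.log (1 + l) ^ p) *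
        ENNReal.ofReal ((∑ k ∈ Finset.range N, 2 ^ k / ρ * D (k + 1) x) ^ p /
        (1 + κ⁻¹ * ∑ i ∈ Finset.range N, D (i + 3) x) ^ 2) := by
      intro x
      set A := ∑ k ∈ Finset.range N, 2 ^ k / ρ * D (k + 1) x
      have hA : 0 ≤ A := Finset.sum_nonneg fun k _ => mul_nonneg (by positivity) (hD0 _ _)
      have hB2 : 0 ≤ κ⁻¹ * ∑ i ∈ Finset.range N, D (i + 3) x :=
        mul_nonneg (by positivity) (Finset.sum_nonneg fun k _ => hD0 _ _)
      have h1 := hpos x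
      -- Only the exponent `2` of the denominator is needed for the energy estimate.
      have h2 : (1 + κ⁻¹ * ∑ i ∈ Finset.range N, D (i + 3) x) ^ 2 ≤ (1 + w N x) ^ p := by
        calc _ ≤ (1 + w N x) ^ 2 := pow_le_pow_left₀ (by linarith) (by linarith [hwD N x]) 2
          _ = (1 + w N x) ^ (2 : ℝ) := (Real.rpow_two _).symm
          _ ≤ _ := Real.rpow_le_rpow_of_exponent_le (by linarith [hw0 N x]) hp
      rw [← ofReal_norm, ENNReal.ofReal_rpow_of_nonneg (norm_nonneg _) (by linarith),
        ← ENNReal.ofReal_mul (by positivity)]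
      refine ENNReal.ofReal_le_ofReal ?_
      calc ‖gradient v x‖ ^ p ≤ ((Real.log (1 + l))⁻¹ * ((1 + w N x)⁻¹ * (C₂ * A))) ^ p :=
            Real.rpow_le_rpow (norm_nonneg _) (hgrad x) (by linarith)
        _ = C₂ ^ p / Real.log (1 + l) ^ p * (A ^ p / (1 + w N x) ^ p) := by
            rw [Real.mul_rpow (by positivity) (by positivity),
              Real.mul_rpow (by positivity) (by positivity), Real.mul_rpow hC₂.le hA,
              Real.inv_rpow hlog.le, Real.inv_rpow h1.le]
            ring
        _ ≤ _ := by gcongr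
    calc ∫⁻ x in U, ‖gradient v x‖ₑ ^ p ≤ ∫⁻ x, ‖gradient v x‖ₑ ^ p := setLIntegral_le_lintegral _ _
      _ ≤ _ := lintegral_mono hpt
      _ ≤ ENNReal.ofReal (C₂ ^ p / Real.log (1 + l) ^ p) *
          (ENNReal.ofReal (C₁ * (4 * B + κ ^ 2)) * ν univ) := by
          rw [lintegral_const_mul' _ _ ENNReal.ofReal_ne_top]
          gcongr
          exact henergy ν ρ B hρ hB N
      _ = _ := by
          rw [← mul_assoc, ← ENNReal.ofReal_mul (by positivity)]
          congr 2
          ring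
  exact (iInf₂_le _ ⟨isOpen_iUnion hopen, hSG, hGU⟩).trans (iSup₂_le hcompact)

/-! ### Lower bound for the capacity of a sphere -/

/-- Jensen's inequality for `x ^ p` and a finite measure, without normalization. -/
theorem lintegral_rpow_le_measure_rpow_mul {α : Type*} [MeasurableSpace α] {μ : Measure α} {p : ℝ}
    (hp : 1 ≤ p) {f : α → ℝ≥0∞} (hf : AEMeasurable f μ) :
    (∫⁻ a, f a ∂μ) ^ p ≤ μ univ ^ (p - 1) * ∫⁻ a, f a ^ p ∂μ := by
  have hp0 : 0 < p := by linarith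
  have h := eLpNorm'_le_eLpNorm'_mul_rpow_measure_univ one_pos hp hf.aestronglyMeasurable
  simp only [eLpNorm', enorm_eq_self, ENNReal.rpow_one, div_one] at h
  calc _ ≤ ((∫⁻ a, f a ^ p ∂μ) ^ (1 / p) * μ univ ^ (1 - 1 / p)) ^ p :=
        ENNReal.rpow_le_rpow h hp0.le
    _ = _ := by
        rw [ENNReal.mul_rpow_of_nonneg _ _ hp0.le, ← ENNReal.rpow_mul, ← ENNReal.rpow_mul,
          one_div_mul_cancel hp0.ne', ENNReal.rpow_one, mul_comm]
        congr 2
        field_simp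

theorem le_pCapacity_of_isCompact {n : ℕ} (p : ℝ) {K U : Set (EuclideanSpace ℝ (Fin n))}
    (hK : IsCompact K) : pCapacityCompact p K U ≤ pCapacity p K U :=
  le_iInf₂ fun _ hG => le_iSup₂_of_le K ⟨hK, hG.2.1⟩ le_rfl

/-- Every segment of length `4 r` in a fixed direction that starts in `B(x₀, r)` meets the sphere,
where a test function is at least `1`, and ends outside `B(x₀, 2 r)`, where it vanishes.
Integrating the resulting lower bound for the energy along the segment over the starting points
gives the claim. -/
theorem exists_le_pCapacity_sphere {n : ℕ} (hn : n ≠ 0) {p : ℝ} (hp : 1 ≤ p) :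
    ∃ c : ℝ, 0 < c ∧ ∀ (x₀ : EuclideanSpace ℝ (Fin n)) (r : ℝ), 0 < r →
      ENNReal.ofReal (c * r ^ ((n : ℝ) - p)) ≤
        pCapacity p (Metric.sphere x₀ r) (Metric.ball x₀ (2 * r)) := by
  set V := volume (Metric.ball (0 : EuclideanSpace ℝ (Fin n)) 1) with hV
  have hVt : V ≠ ∞ := measure_ball_lt_top.ne
  have hV0 : V ≠ 0 := (Metric.measure_ball_pos _ _ one_pos).ne'
  refine ⟨V.toReal / 4 ^ p, div_pos (ENNReal.toReal_pos hV0 hVt) (by positivity),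
    fun x₀ r hr => ?_⟩
  refine le_trans (le_iInf₂ fun u hu => ?_) (le_pCapacity_of_isCompact p (isCompact_sphere x₀ r))
  set e : EuclideanSpace ℝ (Fin n) := EuclideanSpace.single ⟨0, Nat.pos_of_ne_zero hn⟩ 1 with he
  have he1 : ‖e‖ = 1 := by simp [he]
  have hgc : Continuous (gradient u) := by
    have : gradient u = fun x => (InnerProductSpace.toDual ℝ _).symm (fderiv ℝ u x) := rfl
    rw [this]
    exact (LinearIsometryEquiv.continuous _).comp (hu.smooth.continuous_fderiv (by simp))
  have hgm : Measurable fun x => ‖gradient u x‖ₑ ^ p := hgc.measurable.enorm.pow_const p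
  have hzero : ∀ x, x ∉ Metric.ball x₀ (2 * r) → u x = 0 := fun x hx => by
    by_contra h
    exact hx (hu.support_subset (subset_tsupport u h))
  -- Each segment of length `4 r` that starts in the ball meets the sphere and ends outside.
  have hseg : ∀ z ∈ Metric.ball x₀ r,
      1 ≤ ENNReal.ofReal ((4 * r) ^ (p - 1)) *
        ∫⁻ t in Ioc 0 (4 * r), ‖gradient u (z + t • e)‖ₑ ^ p := by
    intro z hz
    have hlinec : Continuous fun t : ℝ => z + t • e := by fun_prop
    have hdistc : Continuous fun t : ℝ => dist (z + t • e) x₀ := hlinec.dist continuous_const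
    have hz' : dist z x₀ < r := hz
    have hfar : 3 * r ≤ dist (z + (4 * r) • e) x₀ := by
      have h1 : dist (z + (4 * r) • e) z = 4 * r := by
        rw [dist_self_add_left, norm_smul, he1, mul_one, Real.norm_of_nonneg (by linarith)]
      linarith [dist_triangle_right (z + (4 * r) • e) z x₀]
    obtain ⟨t₁, ht₁, ht₁r⟩ := intermediate_value_Icc (by linarith : (0 : ℝ) ≤ 4 * r)
      hdistc.continuousOn (show r ∈ Icc _ _ from ⟨by simpa using hz'.le, by linarith⟩)
    have hone : 1 ≤ u (z + t₁ • e) := hu.one_le _ ht₁r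
    have hend : u (z + (4 * r) • e) = 0 := hzero _ fun h => by
      have : dist (z + (4 * r) • e) x₀ < 2 * r := h
      linarith
    have hder : ∀ t : ℝ, HasDerivAt (fun t => u (z + t • e)) (fderiv ℝ u (z + t • e) e) t := by
      intro t
      have h1 : HasDerivAt (fun t : ℝ => z + t • e) e t := by
        simpa using ((hasDerivAt_id t).smul_const e).const_add z
      exact ((hu.smooth.differentiable (by simp)) (z + t • e)).hasFDerivAt.comp_hasDerivAt t h1
    have hderc : Continuous fun t : ℝ => fderiv ℝ u (z + t • e) e :=
      ((hu.smooth.continuous_fderiv (by simp)).comp hlinec).clm_apply continuous_const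
    have hftc := intervalIntegral.integral_eq_sub_of_hasDerivAt (a := t₁) (b := 4 * r)
      (fun t _ => hder t) (hderc.intervalIntegrable _ _)
    rw [hend, intervalIntegral.integral_of_le ht₁.2] at hftc
    have hI : 1 ≤ ∫⁻ t in Ioc 0 (4 * r), ‖gradient u (z + t • e)‖ₑ := by
      calc (1 : ℝ≥0∞) ≤ ‖0 - u (z + t₁ • e)‖ₑ := by
            rw [← ofReal_norm, zero_sub, norm_neg, ENNReal.one_le_ofReal]
            exact hone.trans (Real.le_norm_self _)
        _ ≤ ∫⁻ t in Ioc t₁ (4 * r), ‖fderiv ℝ u (z + t • e) e‖ₑ := by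
            rw [← hftc]; exact enorm_integral_le_lintegral_enorm _
        _ ≤ ∫⁻ t in Ioc 0 (4 * r), ‖fderiv ℝ u (z + t • e) e‖ₑ :=
            lintegral_mono_set (Ioc_subset_Ioc_left ht₁.1)
        _ ≤ _ := by
            refine lintegral_mono fun t => ?_
            rw [← ofReal_norm, ← ofReal_norm, norm_gradient]
            refine ENNReal.ofReal_le_ofReal ?_
            simpa [he1] using (fderiv ℝ u (z + t • e)).le_opNorm e
    have hJ := lintegral_rpow_le_measure_rpow_mul (μ := volume.restrict (Ioc 0 (4 * r))) hp
      (hgc.comp hlinec).measurable.enorm.aemeasurable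
    rw [Measure.restrict_apply_univ, Real.volume_Ioc, sub_zero,
      ENNReal.ofReal_rpow_of_nonneg (by linarith) (by linarith)] at hJ
    exact (ENNReal.one_le_rpow hI (by linarith)).trans hJ
  have hgzero : (fun x => ‖gradient u x‖ₑ ^ p).support ⊆ Metric.ball x₀ (2 * r) := fun x hx => by
    refine hu.support_subset ?_
    by_contra h
    refine hx ?_
    have : gradient u x = 0 := by
      rw [← norm_eq_zero, norm_gradient, fderiv_of_notMem_tsupport ℝ h, norm_zero]
    simp only [this, enorm_zero]
    exact ENNReal.zero_rpow_of_pos (by linarith)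
  have hfub : ∫⁻ z in Metric.ball x₀ r, ∫⁻ t in Ioc 0 (4 * r), ‖gradient u (z + t • e)‖ₑ ^ p ≤
      ENNReal.ofReal (4 * r) * ∫⁻ x in Metric.ball x₀ (2 * r), ‖gradient u x‖ₑ ^ p := by
    have hm : Measurable (Function.uncurry fun (z : EuclideanSpace ℝ (Fin n)) (t : ℝ) =>
        ‖gradient u (z + t • e)‖ₑ ^ p) :=
      hgm.comp (by fun_prop : Measurable fun q : EuclideanSpace ℝ (Fin n) × ℝ => q.1 + q.2 • e)
    calc _ ≤ ∫⁻ z, ∫⁻ t in Ioc 0 (4 * r), ‖gradient u (z + t • e)‖ₑ ^ p :=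
          setLIntegral_le_lintegral _ _
      _ = ∫⁻ t in Ioc 0 (4 * r), ∫⁻ z, ‖gradient u (z + t • e)‖ₑ ^ p :=
          lintegral_lintegral_swap hm.aemeasurable
      _ = ∫⁻ _ in Ioc 0 (4 * r), ∫⁻ x, ‖gradient u x‖ₑ ^ p :=
          lintegral_congr fun t =>
            lintegral_add_right_eq_self (fun x => ‖gradient u x‖ₑ ^ p) (t • e)
      _ = _ := by
          rw [setLIntegral_const, Real.volume_Ioc, sub_zero, mul_comm,
            setLIntegral_eq_of_support_subset hgzero]
  have hc0 : ENNReal.ofReal ((4 * r) ^ p) ≠ 0 := by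
    rw [Ne, ENNReal.ofReal_eq_zero, not_le]; positivity
  rw [← ENNReal.mul_le_mul_iff_right hc0 ENNReal.ofReal_ne_top]
  calc ENNReal.ofReal ((4 * r) ^ p) * ENNReal.ofReal (V.toReal / 4 ^ p * r ^ ((n : ℝ) - p))
      = ENNReal.ofReal (r ^ n) * V := by
        rw [← ENNReal.ofReal_mul (by positivity), ← ENNReal.ofReal_toReal hVt,
          ← ENNReal.ofReal_mul (by positivity), ENNReal.toReal_ofReal ENNReal.toReal_nonneg,
          Real.mul_rpow (by norm_num) hr.le, Real.rpow_sub hr, Real.rpow_natCast]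
        congr 1
        field_simp
    _ = ∫⁻ _ in Metric.ball x₀ r, 1 := by
        rw [setLIntegral_const, one_mul, Measure.addHaar_ball_of_pos _ _ hr]; simp [hV]
    _ ≤ ∫⁻ z in Metric.ball x₀ r, ENNReal.ofReal ((4 * r) ^ (p - 1)) *
        ∫⁻ t in Ioc 0 (4 * r), ‖gradient u (z + t • e)‖ₑ ^ p :=
        setLIntegral_mono' Metric.isOpen_ball.measurableSet hseg
    _ ≤ ENNReal.ofReal ((4 * r) ^ (p - 1)) * (ENNReal.ofReal (4 * r) *
        ∫⁻ x in Metric.ball x₀ (2 * r), ‖gradient u x‖ₑ ^ p) := by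
        rw [lintegral_const_mul' _ _ ENNReal.ofReal_ne_top]
        gcongr
    _ = _ := by
        rw [← mul_assoc, ← ENNReal.ofReal_mul (by positivity),
          Real.rpow_sub_one (by positivity)]
        congr 2
        field_simp

/-! ### Small and large scales of the Wolff potential -/

section

variable {n : ℕ} {p : ℝ} {μ : Measure (EuclideanSpace ℝ (Fin n))}

theorem wolffIntegrand_eq_ofReal [IsFiniteMeasure μ] (hp : 1 < p) (x : EuclideanSpace ℝ (Fin n))
    {t : ℝ} (ht : 0 < t) :
    (μ (Metric.ball x t) / ENNReal.ofReal (t ^ ((n : ℝ) - p))) ^ (1 / (p - 1)) /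
        ENNReal.ofReal t =
      ENNReal.ofReal ((μ.real (Metric.ball x t) / t ^ ((n : ℝ) - p)) ^ (1 / (p - 1)) / t) := by
  have hp' : 0 < p - 1 := by linarith
  rw [ENNReal.ofReal_div_of_pos ht,
    ← ENNReal.ofReal_rpow_of_nonneg (p := 1 / (p - 1)) (by positivity) (by positivity),
    ENNReal.ofReal_div_of_pos (by positivity), ofReal_measureReal (measure_ne_top μ _)]

/-- The small scales of the Wolff potential are dominated by its dyadic terms of index at least
`3`. -/
theorem lintegral_Ioc_wolffIntegrand_le [IsFiniteMeasure μ] (hp : 1 < p) (hpn : p ≤ n) {ρ : ℝ}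
    (hρ : 0 < ρ) (x : EuclideanSpace ℝ (Fin n)) :
    ∫⁻ t in Ioc 0 (ρ / 8), (μ (Metric.ball x t) / ENNReal.ofReal (t ^ ((n : ℝ) - p))) ^
        (1 / (p - 1)) / ENNReal.ofReal t ≤
      ∑' k : ℕ, ENNReal.ofReal (wolffRatio n p * wolffTerm p μ ρ (k + 3) x) := by
  have hp' : 0 < p - 1 := by linarith
  have hcover : Ioc 0 (ρ / 8) ⊆ ⋃ k : ℕ, Ioc (ρ / 2 ^ (k + 4)) (ρ / 2 ^ (k + 3)) := fun t ht => by
    obtain ⟨k, hk1, hk2⟩ := exists_nat_pow_near_of_lt_one (x := 8 * t / ρ) (y := 1 / 2)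
      (by have := ht.1; positivity) (by rw [div_le_one hρ]; linarith [ht.2]) (by norm_num)
      (by norm_num)
    refine mem_iUnion.2 ⟨k, ?_, ?_⟩
    · rw [lt_div_iff₀ hρ, one_div_pow] at hk1
      have e : ρ / 2 ^ (k + 4) = (1 / 2 ^ (k + 1) * ρ) / 8 := by
        rw [show k + 4 = k + 1 + 3 by ring, pow_add _ (k + 1)]; field_simp; norm_num
      rw [e]; linarith
    · rw [div_le_iff₀ hρ, one_div_pow] at hk2
      have e : ρ / 2 ^ (k + 3) = (1 / 2 ^ k * ρ) / 8 := by
        rw [pow_add]; field_simp; norm_num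
      rw [e]; linarith
  refine (lintegral_mono_set hcover).trans ((lintegral_iUnion_le _ _).trans
    (ENNReal.tsum_le_tsum fun k => ?_))
  set σ := ρ / 2 ^ (k + 4) with hσ
  have hσ0 : 0 < σ := by positivity
  have e : ρ / 2 ^ (k + 3) = 2 * σ := by rw [hσ, pow_succ _ (k + 3)]; field_simp
  have hterm : wolffRatio n p * wolffTerm p μ ρ (k + 3) x =
      (μ.real (Metric.ball x (2 * σ)) / σ ^ ((n : ℝ) - p)) ^ (1 / (p - 1)) := by
    rw [wolffRatio, wolffTerm, e, div_eq_mul_one_div ((n : ℝ) - p), Real.rpow_mul (by norm_num),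
      ← Real.mul_rpow (by positivity) (by positivity), Real.mul_rpow (by norm_num) hσ0.le]
    congr 1
    field_simp
  calc _ ≤ ∫⁻ _ in Ioc σ (ρ / 2 ^ (k + 3)),
        ENNReal.ofReal (wolffRatio n p * wolffTerm p μ ρ (k + 3) x / σ) := by
        refine setLIntegral_mono' measurableSet_Ioc fun t ht => ?_
        have ht0 : 0 < t := hσ0.trans ht.1
        rw [wolffIntegrand_eq_ofReal hp x ht0, hterm]
        refine ENNReal.ofReal_le_ofReal (div_le_div₀ (by positivity) ?_ hσ0 ht.1.le)
        refine Real.rpow_le_rpow (by positivity) (div_le_div₀ measureReal_nonneg ?_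
          (by positivity) (Real.rpow_le_rpow hσ0.le ht.1.le (by linarith))) (by positivity)
        exact measureReal_mono (Metric.ball_subset_ball (ht.2.trans_eq e))
    _ = _ := by
        have h0 := wolffTerm_nonneg (p := p) (ν := μ) hρ (k + 3) x
        have hκ := wolffRatio_pos n p
        rw [setLIntegral_const, Real.volume_Ioc, e, ← ENNReal.ofReal_mul (by positivity)]
        congr 1
        field_simp
        ring

theorem lintegral_Ioi_wolffIntegrand_le [IsFiniteMeasure μ] (hp : 1 < p) {m C a : ℝ}
    (hmn : m < n - p) (hC : 0 ≤ C) (ha : 0 < a) {x : EuclideanSpace ℝ (Fin n)}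
    (h : ∀ t, a < t → μ.real (Metric.ball x t) ≤ C * t ^ m) :
    ∫⁻ t in Ioi a, (μ (Metric.ball x t) / ENNReal.ofReal (t ^ ((n : ℝ) - p))) ^
        (1 / (p - 1)) / ENNReal.ofReal t ≤
      ENNReal.ofReal (C ^ (1 / (p - 1)) / ((n - p - m) / (p - 1)) *
        a ^ (-((n - p - m) / (p - 1)))) := by
  have hp' : 0 < p - 1 := by linarith
  set α := (n - p - m) / (p - 1) with hα
  have hα0 : 0 < α := div_pos (by linarith) hp'
  calc _ ≤ ∫⁻ t in Ioi a, ENNReal.ofReal (C ^ (1 / (p - 1)) * t ^ (-α - 1)) := by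
        refine setLIntegral_mono' measurableSet_Ioi fun t (ht : a < t) => ?_
        have ht0 : 0 < t := ha.trans ht
        rw [wolffIntegrand_eq_ofReal hp x ht0]
        refine ENNReal.ofReal_le_ofReal ?_
        have e : C ^ (1 / (p - 1)) * t ^ (-α - 1) =
            (C * t ^ m / t ^ ((n : ℝ) - p)) ^ (1 / (p - 1)) / t := by
          rw [mul_div_assoc, ← Real.rpow_sub ht0, Real.mul_rpow hC (by positivity),
            ← Real.rpow_mul ht0.le, Real.rpow_sub_one ht0.ne']
          have : (m - (n - p)) * (1 / (p - 1)) = -α := by rw [hα]; ring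
          rw [this]; ring
        rw [e]
        gcongr
        exact h t ht
    _ = ENNReal.ofReal (∫ t in Ioi a, C ^ (1 / (p - 1)) * t ^ (-α - 1)) := by
        refine (ofReal_integral_eq_lintegral_ofReal
          ((integrableOn_Ioi_rpow_of_lt (by linarith) ha).const_mul _) ?_).symm
        refine (ae_restrict_iff' measurableSet_Ioi).2 (Filter.Eventually.of_forall fun t ht => ?_)
        have : 0 < t := ha.trans ht
        show 0 ≤ C ^ (1 / (p - 1)) * t ^ (-α - 1)
        positivity
    _ = _ := by
        rw [integral_const_mul, integral_Ioi_rpow_of_lt (by linarith) ha]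
        congr 1
        rw [sub_add_cancel]
        field_simp

/-- For a finite measure the growth condition at small radii extends to all radii. -/
theorem exists_measureReal_ball_le [IsFiniteMeasure μ] {x₀ : EuclideanSpace ℝ (Fin n)}
    {R C₀ m : ℝ} (hR : 0 < R) (hm : 0 < m)
    (h : ∀ t ∈ Ioo 0 R, μ (Metric.ball x₀ t) ≤ ENNReal.ofReal (C₀ * t ^ m)) :
    ∃ C : ℝ, 0 < C ∧ ∀ t, 0 < t → μ.real (Metric.ball x₀ t) ≤ C * t ^ m := by
  refine ⟨|C₀| + μ.real univ / R ^ m + 1, by positivity, fun t ht => ?_⟩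
  have htm : 0 < t ^ m := by positivity
  have hu : 0 ≤ μ.real univ / R ^ m := by positivity
  rcases lt_or_ge t R with htR | htR
  · have h1 : μ.real (Metric.ball x₀ t) ≤ |C₀| * t ^ m := by
      refine ENNReal.toReal_le_of_le_ofReal (by positivity) ((h t ⟨ht, htR⟩).trans ?_)
      exact ENNReal.ofReal_le_ofReal (by gcongr; exact le_abs_self _)
    nlinarith
  · have h1 : μ.real univ ≤ μ.real univ / R ^ m * t ^ m := by
      rw [div_mul_eq_mul_div, le_div_iff₀ (by positivity)]
      gcongr
    have h2 : μ.real (Metric.ball x₀ t) ≤ μ.real univ := measureReal_mono (subset_univ _)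
    nlinarith [abs_nonneg C₀]

end

/-! ### The exceptional set in one annulus -/

/-- The capacity, relative to a neighbourhood of the annulus `r ≤ |x - x₀| ≤ 2 r`, of the part of
the annulus where the Wolff potential is too large. -/
theorem exists_pCapacity_wolffPotential_gt_le (n : ℕ) {p m ε C₁ : ℝ} (hp : 2 ≤ p)
    (hm : 0 < m) (hmn : m < n - p) (hε : 0 < ε) (hC₁ : 0 < C₁) :
    ∃ C A : ℝ, 0 < C ∧ 0 < A ∧ ∀ (μ : Measure (EuclideanSpace ℝ (Fin n))) [IsFiniteMeasure μ]
      (x₀ : EuclideanSpace ℝ (Fin n)) (r r₀ : ℝ) (S : Set (EuclideanSpace ℝ (Fin n))),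
      0 < r → r ≤ 1 → (∀ t, 0 < t → μ.real (Metric.ball x₀ t) ≤ C₁ * t ^ m) →
      (∀ x ∈ S, r ≤ ‖x - x₀‖ ∧ ‖x - x₀‖ ≤ 2 * r ∧
        ENNReal.ofReal C * ‖x - x₀‖ₑ ^ (-((n - p - m + ε) / (p - 1))) < wolffPotential p μ x r₀) →
      pCapacity p S {x | r / 2 < ‖x - x₀‖ ∧ ‖x - x₀‖ < 4 * r} ≤
        ENNReal.ofReal (A * r ^ ((n : ℝ) - p) /
          Real.log (1 + (wolffRatio n p)⁻¹ * r ^ (-(ε / (p - 1)))) ^ p) := by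
  obtain ⟨C₂, hC₂, hcap⟩ := exists_pCapacity_le n hp
  have hκ := wolffRatio_pos n p
  set κ := wolffRatio n p
  have hp1 : 1 < p := by linarith
  have hp' : 0 < p - 1 := by linarith
  set α := (n - p - m) / (p - 1) with hα
  set β := (n - p - m + ε) / (p - 1) with hβ
  set γ := ε / (p - 1) with hγ
  have hα0 : 0 < α := div_pos (by linarith) hp'
  have hγ0 : 0 < γ := div_pos hε hp'
  have hβαγ : β = α + γ := by rw [hα, hβ, hγ]; ring
  set B := (C₁ * 3 ^ m * 16 ^ ((n : ℝ) - p)) ^ (1 / (p - 1))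
  set C₃ := (C₁ * 33 ^ m) ^ (1 / (p - 1)) / α * 16 ^ α with hC₃
  have hC₃0 : 0 < C₃ := by positivity
  refine ⟨(κ + C₃) * 2 ^ β, C₂ * (4 * B + κ ^ 2) * (C₁ * 3 ^ m), by positivity, by positivity,
    fun μ _ x₀ r r₀ S hr hr1 hgrow hS => ?_⟩
  -- The part of `μ` near the annulus, normalized so that its mass is at most `C r ^ (n - p)`.
  set s := r ^ (m - (n - p)) with hs
  have hs0 : 0 < s := by positivity
  set Q : Set (EuclideanSpace ℝ (Fin n)) :=
    {z | 15 / 16 * r ≤ dist z x₀ ∧ dist z x₀ ≤ 33 / 16 * r}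
  have hdc : Continuous fun z : EuclideanSpace ℝ (Fin n) => dist z x₀ := by fun_prop
  have hQm : MeasurableSet Q :=
    ((isClosed_le continuous_const hdc).inter (isClosed_le hdc continuous_const)).measurableSet
  set ν : Measure (EuclideanSpace ℝ (Fin n)) := ENNReal.ofReal s⁻¹ • μ.restrict Q with hν
  have : IsFiniteMeasure ν := Measure.smul_finite _ ENNReal.ofReal_ne_top
  have hνreal : ∀ T, MeasurableSet T → ν.real T = s⁻¹ * μ.real (T ∩ Q) := fun T hT => by
    rw [hν, measureReal_ennreal_smul_apply, ENNReal.toReal_ofReal (by positivity),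
      measureReal_restrict_apply hT]
  have hmass : ν.real univ ≤ C₁ * 3 ^ m * r ^ ((n : ℝ) - p) := by
    rw [hνreal _ MeasurableSet.univ, univ_inter]
    have h1 : μ.real Q ≤ C₁ * (3 * r) ^ m := (measureReal_mono fun z hz => by
      have := hz.2
      rw [Metric.mem_ball]; linarith).trans (hgrow (3 * r) (by linarith))
    have h2 : s⁻¹ * (C₁ * (3 * r) ^ m) = C₁ * 3 ^ m * r ^ ((n : ℝ) - p) := by
      rw [hs, ← Real.rpow_neg hr.le, Real.mul_rpow (by norm_num) hr.le]
      have : r ^ (-(m - (n - p))) * r ^ m = r ^ ((n : ℝ) - p) := by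
        rw [← Real.rpow_add hr]; congr 1; ring
      rw [← this]; ring
    rw [← h2]; gcongr
  have hBD : ∀ k < 4, ∀ x, wolffTerm p ν (r / 2) k x ≤ B := fun k hk x => by
    refine (wolffTerm_le hp1 (by linarith) k x).trans
      (Real.rpow_le_rpow (by positivity) ?_ (by positivity))
    have h1 : r / 16 ≤ r / 2 / 2 ^ k := by
      have : (2 : ℝ) ^ k ≤ 2 ^ 3 := pow_le_pow_right₀ one_le_two (by omega)
      rw [div_div]
      gcongr
      linarith
    have h2 : (r / 16) ^ ((n : ℝ) - p) ≤ (r / 2 / 2 ^ k) ^ ((n : ℝ) - p) :=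
      Real.rpow_le_rpow (by positivity) h1 (by linarith)
    rw [div_le_iff₀ (by positivity)]
    refine hmass.trans (le_trans (le_of_eq ?_) (mul_le_mul_of_nonneg_left h2 (by positivity)))
    rw [Real.div_rpow hr.le (by norm_num)]
    field_simp
  -- Otherwise both the small and the large scales are at most a multiple of `r ^ (-β)`.
  have hlarge : ∀ x ∈ S, ∃ N : ℕ, κ * (κ⁻¹ * r ^ (-γ)) <
      ∑ k ∈ Finset.range N, wolffTerm p ν (r / 2) (k + 3) x := by
    intro x hx
    obtain ⟨hx1, hx2, hx3⟩ := hS x hx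
    rw [mul_inv_cancel_left₀ hκ.ne']
    by_contra! hN
    refine hx3.not_ge ?_
    -- On the annulus, balls of radius at most `r / 16` lie in `Q`, where `μ` and `ν` differ by `s`.
    have hterm : ∀ k : ℕ, wolffTerm p μ (r / 2) (k + 3) x =
        r ^ (-α) * wolffTerm p ν (r / 2) (k + 3) x := fun k => by
      have hsub : Metric.ball x (r / 2 / 2 ^ (k + 3)) ⊆ Q := fun z hz => by
        have h1 : dist z x < r / 16 := by
          refine (Metric.mem_ball.1 hz).trans_le ?_
          have : (1 : ℝ) ≤ 2 ^ k := one_le_pow₀ one_le_two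
          rw [div_div, pow_add]
          gcongr
          linarith
        have h2 := dist_triangle z x x₀
        have h3 := dist_triangle x z x₀
        rw [dist_comm x z] at h3
        rw [dist_eq_norm x x₀] at h2 h3
        exact ⟨by linarith, by linarith⟩
      have h1 : r ^ (-α) = s ^ (1 / (p - 1)) := by
        rw [hs, ← Real.rpow_mul hr.le]; congr 1; rw [hα]; ring
      rw [h1, wolffTerm, wolffTerm, hνreal _ Metric.isOpen_ball.measurableSet,
        inter_eq_left.2 hsub, ← Real.mul_rpow hs0.le (by positivity)]
      congr 1
      field_simp
    have hsmall : ∫⁻ t in Ioc 0 (r / 2 / 8), (μ (Metric.ball x t) /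
        ENNReal.ofReal (t ^ ((n : ℝ) - p))) ^ (1 / (p - 1)) / ENNReal.ofReal t ≤
        ENNReal.ofReal (κ * r ^ (-β)) := by
      refine (lintegral_Ioc_wolffIntegrand_le hp1 (by linarith) (by linarith) x).trans
        (ENNReal.tsum_le_of_sum_range_le fun N => ?_)
      rw [← ENNReal.ofReal_sum_of_nonneg fun k _ =>
        mul_nonneg hκ.le (wolffTerm_nonneg (by linarith) _ _)]
      refine ENNReal.ofReal_le_ofReal ?_
      simp only [hterm]
      rw [← Finset.mul_sum, ← Finset.mul_sum, hβαγ, neg_add, Real.rpow_add hr]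
      gcongr
      exact hN N
    have hbig : ∫⁻ t in Ioi (r / 2 / 8), (μ (Metric.ball x t) /
        ENNReal.ofReal (t ^ ((n : ℝ) - p))) ^ (1 / (p - 1)) / ENNReal.ofReal t ≤
        ENNReal.ofReal (C₃ * r ^ (-β)) := by
      refine (lintegral_Ioi_wolffIntegrand_le hp1 hmn (C := C₁ * 33 ^ m) (by positivity)
        (by positivity) fun t ht => ?_).trans (ENNReal.ofReal_le_ofReal ?_)
      · have ht0 : 0 < t := by linarith
        rw [mul_assoc, ← Real.mul_rpow (by norm_num) ht0.le]
        refine (measureReal_mono (Metric.ball_subset_ball' ?_)).trans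
          (hgrow (33 * t) (by linarith))
        rw [dist_eq_norm]; linarith
      · have e : (r / 2 / 8) ^ (-α) = 16 ^ α * r ^ (-α) := by
          rw [div_div, Real.div_rpow hr.le (by norm_num),
            Real.rpow_neg (by norm_num : (0 : ℝ) ≤ 2 * 8)]
          norm_num [mul_comm]
        rw [← hα, e, hC₃, ← mul_assoc]
        exact mul_le_mul_of_nonneg_left
          (Real.rpow_le_rpow_of_exponent_ge hr hr1 (by linarith)) (by positivity)
    calc wolffPotential p μ x r₀
        ≤ ENNReal.ofReal (κ * r ^ (-β)) + ENNReal.ofReal (C₃ * r ^ (-β)) := by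
          refine le_trans (lintegral_mono_set fun t ht => ?_)
            ((lintegral_union_le _ (Ioc 0 (r / 2 / 8)) (Ioi (r / 2 / 8))).trans
              (add_le_add hsmall hbig))
          exact (le_or_gt t (r / 2 / 8)).imp (fun h => ⟨ht.1, h⟩) id
      _ = ENNReal.ofReal ((κ + C₃) * r ^ (-β)) := by
          rw [← ENNReal.ofReal_add (by positivity) (by positivity), add_mul]
      _ ≤ _ := by
          have hx0 : 0 < ‖x - x₀‖ := hr.trans_le hx1
          rw [← ofReal_norm, ENNReal.ofReal_rpow_of_pos hx0, ← ENNReal.ofReal_mul (by positivity),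
            mul_assoc]
          refine ENNReal.ofReal_le_ofReal (mul_le_mul_of_nonneg_left ?_ (by positivity))
          have h1 : (‖x - x₀‖ / 2) ^ (-β) = 2 ^ β * ‖x - x₀‖ ^ (-β) := by
            rw [Real.div_rpow hx0.le (by norm_num), Real.rpow_neg (by norm_num : (0 : ℝ) ≤ 2),
              div_inv_eq_mul, mul_comm]
          rw [← h1]
          exact Real.rpow_le_rpow_of_nonpos (by positivity) (by linarith) (by linarith)
  have hK₀ : IsCompact (Metric.closedBall x₀ (3 * r) ∩ {x | 5 / 8 * r ≤ dist x x₀}) :=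
    (isCompact_closedBall _ _).inter_right (isClosed_le continuous_const hdc)
  have hfin := hcap ν (r / 2) B (κ⁻¹ * r ^ (-γ))
    (Metric.closedBall x₀ (3 * r) ∩ {x | 5 / 8 * r ≤ dist x x₀})
    {x | r / 2 < ‖x - x₀‖ ∧ ‖x - x₀‖ < 4 * r} S (by linarith) hBD (by positivity) hK₀
    (fun x hx => by
      have h1 : dist x x₀ ≤ 3 * r := hx.1
      have h2 : 5 / 8 * r ≤ dist x x₀ := hx.2
      rw [dist_eq_norm] at h1 h2
      exact ⟨by linarith, by linarith⟩)
    (fun x hx => by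
      have h1 : (Metric.ball x (r / 2 / 2) ∩ Q).Nonempty := by
        by_contra h
        refine hx ?_
        rw [hν, Measure.smul_apply, Measure.restrict_apply Metric.isOpen_ball.measurableSet,
          not_nonempty_iff_eq_empty.1 h, measure_empty, smul_zero]
      obtain ⟨z, hz1, hz2, hz3⟩ := h1
      have h1 : dist z x < r / 2 / 2 := hz1
      have h2 := dist_triangle z x x₀
      have h3 := dist_triangle x z x₀
      rw [dist_comm x z] at h3
      refine ⟨?_, ?_⟩
      · rw [Metric.mem_closedBall]; linarith
      · show 5 / 8 * r ≤ dist x x₀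
        linarith) hlarge
  refine hfin.trans ?_
  rw [← ofReal_measureReal (measure_ne_top ν _)]
  have hlog : 0 < Real.log (1 + κ⁻¹ * r ^ (-γ)) := Real.log_pos (by
    have : 0 < κ⁻¹ * r ^ (-γ) := by positivity
    linarith)
  rw [← ENNReal.ofReal_mul (by positivity)]
  refine ENNReal.ofReal_le_ofReal ?_
  rw [div_mul_eq_mul_div, mul_assoc _ (C₁ * 3 ^ m)]
  gcongr

/-! ### Thinness of the exceptional set -/

/-- Linear growth in `i` of the logarithm in the capacity estimate for `r = 2 ^ (-i)`. Bernoulli's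
inequality removes the factor `κ⁻¹` inside the logarithm. -/
theorem mul_log_two_le_log_one_add {κ : ℝ} (hκ : 1 ≤ κ) {γ : ℝ} (i : ℕ) :
    κ⁻¹ * (γ * Real.log 2) * i ≤ Real.log (1 + κ⁻¹ * ((2 : ℝ) ^ (-(i : ℤ))) ^ (-γ)) := by
  set X := ((2 : ℝ) ^ (-(i : ℤ))) ^ (-γ) with hX
  have hX0 : 0 < X := by positivity
  have hXlog : Real.log X = γ * Real.log 2 * i := by
    rw [hX, Real.log_rpow (by positivity), Real.log_zpow]; push_cast; ring
  calc κ⁻¹ * (γ * Real.log 2) * i = κ⁻¹ * Real.log X := by rw [hXlog]; ring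
    _ ≤ κ⁻¹ * Real.log (1 + X) := by gcongr; linarith
    _ = Real.log ((1 + X) ^ κ⁻¹) := (Real.log_rpow (by linarith) _).symm
    _ ≤ _ := Real.log_le_log (by positivity)
        (rpow_one_add_le_one_add_mul_self (by linarith) (by positivity) (inv_le_one_of_one_le₀ hκ))

theorem theorem5p2 (n : ℕ) (p : ℝ) (hp2 : 2 ≤ p) (hpn : p < n)
    (Ω : Set (EuclideanSpace ℝ (Fin n))) (hΩ : IsOpen Ω)
    (μ : MeasureTheory.Measure (EuclideanSpace ℝ (Fin n)))
    [MeasureTheory.IsFiniteMeasure μ] (hμΩ : μ Ωᶜ = 0)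
    (x₀ : EuclideanSpace ℝ (Fin n)) (hx₀ : x₀ ∈ Ω)
    (r₀ : ℝ) (hr₀ : 0 < r₀) (hball : Metric.ball x₀ (3 * r₀) ⊆ Ω)
    (m : ℝ) (hm0 : 0 < m) (hmn : m < n - p)
    (C₀ : ℝ) (hμ : ∀ t ∈ Set.Ioo (0 : ℝ) (3 * r₀),
      μ (Metric.ball x₀ t) ≤ ENNReal.ofReal (C₀ * t ^ m))
    (ε : ℝ) (hε : 0 < ε) :
    ∃ E : Set (EuclideanSpace ℝ (Fin n)), E ⊆ Ω ∧ IsPThin p E x₀ ∧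
      ∃ C : ℝ, 0 < C ∧ ∀ x ∈ Ω \ E,
        wolffPotential p μ x r₀ ≤
          ENNReal.ofReal C * ‖x - x₀‖ₑ ^ (-((n - p - m + ε) / (p - 1))) := by
  obtain ⟨C₁, hC₁, hgrow⟩ := exists_measureReal_ball_le (by linarith : 0 < 3 * r₀) hm0 hμ
  obtain ⟨C, A, hC, hA, hcap⟩ := exists_pCapacity_wolffPotential_gt_le n hp2 hm0 hmn hε hC₁
  have hn : n ≠ 0 := fun h => by rw [h, Nat.cast_zero] at hpn; linarith
  obtain ⟨c, hc, hsphere⟩ := exists_le_pCapacity_sphere hn (by linarith : 1 ≤ p)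
  refine ⟨{x ∈ Ω | ENNReal.ofReal C * ‖x - x₀‖ₑ ^ (-((n - p - m + ε) / (p - 1))) <
    wolffPotential p μ x r₀}, sep_subset _ _, ?_, C, hC, fun x hx =>
      not_lt.1 fun h => hx.2 ⟨hx.1, h⟩⟩
  have hp' : 0 < p - 1 := by linarith
  set κ := wolffRatio n p
  have hκ1 : 1 ≤ κ := Real.one_le_rpow one_le_two (div_nonneg (by linarith) hp'.le)
  set b := κ⁻¹ * (ε / (p - 1) * Real.log 2) with hb
  have hb0 : 0 < b := by
    have := Real.log_pos one_lt_two
    positivity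
  have hsum : Summable fun j : ℕ => A / c / b ^ p * (1 / ((j + 1 : ℕ) : ℝ) ^ p) :=
    ((summable_nat_add_iff 1).2 (Real.summable_one_div_nat_rpow.2 (by linarith))).mul_left _
  refine lt_of_le_of_lt (ENNReal.tsum_le_tsum fun j => ?_) hsum.tsum_ofReal_lt_top
  set r : ℝ := (2 : ℝ) ^ (-((j + 1 : ℕ) : ℤ)) with hr
  have hr0 : 0 < r := by positivity
  have hr1 : r ≤ 1 := zpow_le_one_of_nonpos₀ one_le_two (by omega)
  have e1 : (2 : ℝ) ^ (-((j + 1 : ℕ) : ℤ) + 1) = 2 * r := by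
    rw [zpow_add₀ two_ne_zero, zpow_one, mul_comm]
  have e2 : (2 : ℝ) ^ (-((j + 1 : ℕ) : ℤ) - 1) = r / 2 := by
    rw [zpow_sub₀ two_ne_zero, zpow_one]
  have e3 : (2 : ℝ) ^ (-((j + 1 : ℕ) : ℤ) + 2) = 4 * r := by
    rw [zpow_add₀ two_ne_zero, mul_comm, ← hr]; congr 1; norm_num
  have hnbhd : dyadicAnnulusNhd x₀ (j + 1) = {x | r / 2 < ‖x - x₀‖ ∧ ‖x - x₀‖ < 4 * r} := by
    rw [dyadicAnnulusNhd, e2, e3]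
  have hnum := hcap μ x₀ r r₀ ({x ∈ Ω | ENNReal.ofReal C *
      ‖x - x₀‖ₑ ^ (-((n - p - m + ε) / (p - 1))) < wolffPotential p μ x r₀} ∩
      dyadicAnnulus x₀ (j + 1)) hr0 hr1 hgrow
    fun x hx => ⟨hx.2.1, hx.2.2.trans_eq e1, hx.1.2⟩
  have hden := hsphere x₀ r hr0
  rw [hnbhd, e1]
  refine (ENNReal.div_le_div hnum hden).trans ?_
  rw [← ENNReal.ofReal_div_of_pos (by positivity)]
  refine ENNReal.ofReal_le_ofReal ?_
  have hlog := mul_log_two_le_log_one_add (γ := ε / (p - 1)) hκ1 (j + 1)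
  rw [← hb, ← hr] at hlog
  have hj : (0 : ℝ) < ((j + 1 : ℕ) : ℝ) := by positivity
  have hl : 0 < Real.log (1 + κ⁻¹ * r ^ (-(ε / (p - 1)))) :=
    (by positivity : 0 < b * _).trans_le hlog
  calc A * r ^ ((n : ℝ) - p) / Real.log (1 + κ⁻¹ * r ^ (-(ε / (p - 1)))) ^ p /
        (c * r ^ ((n : ℝ) - p))
      = A / c / Real.log (1 + κ⁻¹ * r ^ (-(ε / (p - 1)))) ^ p := by field_simp
    _ ≤ A / c / (b * ((j + 1 : ℕ) : ℝ)) ^ p := by gcongr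
    _ = _ := by rw [Real.mul_rpow hb0.le hj.le]; field_simp
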